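/- Call a simple curve $\gamma:[a,b]\to\mathbb C$ ($a<b$) a Lipschitz curve if it is bi-Lipschitz, i.e. $C_1|t-s|\le|\gamma(t)-\gamma(s)|\le C_2|t-s|$ for some constants $C_1,C_2>0$, and its image $\Gamma=\gamma([a,b])$ is locally (near each of its points, in suitable rotated coordinates) the graph of a Lipschitz function over an interval. For a closed set $\Gamma\subset\overline{\mathbb C}$ let $\mathcal H_\Gamma$ be the set of functions $f$ holomorphic on $\overline{\mathbb C}\setminus\Gamma$, where $\overline{\mathbb C}=\mathbb C\cup\{\infty\}$ is the Riemann sphere, that are slowly growing near $\Gamma$: there are $N\in\mathbb N$ and $K>0$ with $|f(z)|\le K\,\operatorname{dist}_{\overline{\mathbb C}}(z,\Gamma)^{-N}$ for all $z\in\overline{\mathbb C}\setminus\Gamma$, where $\operatorname{dist}_{\overline{\mathbb C}}$ is the great-circle distance of the round metric on $\overline{\mathbb C}$. Let $f\in\mathcal H_\Gamma$ and $t_0\in[a,b]$. A simple $(0)$-normal form of $f$ is a constant $c_0\in\mathbb C$ with $f(z)=c_0$ for all $z\in\mathbb C\setminus\Gamma$. For $m\in\mathbb N=\{0,1,2,\dots\}$,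 a simple $(m+1)$-normal form of $f$ with base point $\gamma(t_0)$ consists of $c_0,\dots,c_m\in\mathbb C$ and a complex Borel measure $\mu$ on $[a,b]$ such that $$f(z)=\sum_{j=0}^{m}\frac{c_j}{(\gamma(t_0)-z)^j}+\int_{[a,b]}\frac{d\mu(t)}{(\gamma(t)-z)^{m+1}}\qquad\text{for all } z\in\mathbb C\setminus\Gamma .$$ **Proposition.** Let $\gamma:[a,b]\to\mathbb C$ be a Lipschitz curve with image $\Gamma$. 1. For every $f\in\mathcal H_\Gamma$ there is $n\in\mathbb N$ such that, for every $t_0\in[a,b]$, $f$ has a simple $(n)$-normal form with base point $\gamma(t_0)$. 2. For every $f\in\mathcal H_\Gamma$, $n\in\mathbb N$ and $t_0\in[a,b]$, $f$ has at most one simple $(n)$-normal form with base point $\gamma(t_0)$: the coefficients $c_j$ and the measure $\mu$ are uniquely determined. -/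

import Mathlib

noncomputable section

open MeasureTheory Set
open scoped NNReal

namespace LipCurve

/-- `Γ` is locally the graph of a Lipschitz function: every point of `Γ` has an open neighbourhood
`U` such that, in the orthonormal coordinates `(u, v)` obtained by a rotation `e`, the set `U ∩ Γ`
is the graph of a Lipschitz function over an interval `I`. -/
def IsLocallyLipschitzGraph (Γ : Set ℂ) : Prop :=
  ∀ w ∈ Γ, ∃ U : Set ℂ, IsOpen U ∧ w ∈ U ∧
    ∃ (e : ℂ) (I : Set ℝ) (φ : ℝ → ℝ) (K : ℝ≥0), ‖e‖ = 1 ∧ I.OrdConnected ∧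
      LipschitzOnWith K φ I ∧
      U ∩ Γ = (fun u : ℝ => e * ((u : ℂ) + Complex.I * (φ u : ℂ))) '' I

/-- A Lipschitz curve in the plane with a bi-Lipschitz parametrization. (The bounds make `γ`
continuous and injective, so the curve is simple.) -/
structure IsLipschitzCurve {a b : ℝ} (γ : Icc a b → ℂ) : Prop where
  lipschitz : ∃ C : ℝ≥0, LipschitzWith C γ
  antilipschitz : ∃ C : ℝ≥0, AntilipschitzWith C γ
  graph : IsLocallyLipschitzGraph (range γ)

/-- The chart `w ↦ 1 / w` of the Riemann sphere around `∞`, with `0 ↦ ∞`. -/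
def invChart (w : ℂ) : OnePoint ℂ := if w = 0 then OnePoint.infty else ((w⁻¹ : ℂ) : OnePoint ℂ)

/-- Holomorphy of a function on an open subset `U` of the Riemann sphere, in the two
standard charts. -/
def SphereHolomorphicOn (f : OnePoint ℂ → ℂ) (U : Set (OnePoint ℂ)) : Prop :=
  DifferentiableOn ℂ (fun z : ℂ => f (z : OnePoint ℂ)) {z : ℂ | (z : OnePoint ℂ) ∈ U} ∧
  DifferentiableOn ℂ (fun w : ℂ => f (invChart w)) {w : ℂ | invChart w ∈ U}

/-- Half of the chordal distance on the Riemann sphere, i.e. half of the Euclidean distance of the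
stereographic images on the unit sphere. -/
def halfChord : OnePoint ℂ → OnePoint ℂ → ℝ
  | OnePoint.infty, OnePoint.infty => 0
  | OnePoint.infty, OnePoint.some w => 1 / √(1 + ‖w‖ ^ 2)
  | OnePoint.some z, OnePoint.infty => 1 / √(1 + ‖z‖ ^ 2)
  | OnePoint.some z, OnePoint.some w => ‖z - w‖ / (√(1 + ‖z‖ ^ 2) * √(1 + ‖w‖ ^ 2))

/-- The Riemannian (great circle) distance of the round metric on the Riemann sphere. -/
def sphereDist (p q : OnePoint ℂ) : ℝ := 2 * Real.arcsin (halfChord p q)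

/-- The distance of a point of the Riemann sphere from a (nonempty) set. -/
def sphereDistTo (p : OnePoint ℂ) (Γ : Set (OnePoint ℂ)) : ℝ := ⨅ q : Γ, sphereDist p q

/-- The slowly growing holomorphic functions on the complement of the closed subset `Γ` of the
Riemann sphere. The values on `Γ` of the representing total function are irrelevant. -/
def slowlyGrowing (Γ : Set (OnePoint ℂ)) : Set (OnePoint ℂ → ℂ) :=
  {f | SphereHolomorphicOn f Γᶜ ∧
    ∃ (n : ℕ) (K : ℝ), 0 < K ∧ ∀ p ∉ Γ, ‖f p‖ ≤ K / sphereDistTo p Γ ^ n}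

/-- The image of a plane curve, as a subset of the Riemann sphere. -/
def sphereTrace {a b : ℝ} (γ : Icc a b → ℂ) : Set (OnePoint ℂ) :=
  range fun t => ((γ t : ℂ) : OnePoint ℂ)

/-- The integral of a complex function against a complex measure. -/
def cintegral {X : Type*} [MeasurableSpace X] (μ : ComplexMeasure X) (g : X → ℂ) : ℂ :=
  VectorMeasure.integral μ g (ContinuousLinearMap.mul ℝ ℂ)

/-- The data of a simple `n`-normal form: a constant if `n = 0`; coefficients `c₀, …, cₘ` and a
complex Borel measure on `[a, b]` if `n = m + 1`. -/
def NormalFormData (a b : ℝ) : ℕ → Type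
  | 0 => ℂ
  | m + 1 => (Fin (m + 1) → ℂ) × ComplexMeasure (Icc a b)

/-- The function on `ℂ ∖ Γ` given by the data of a simple normal form with base point `γ t₀`. -/
def normalFormFun {a b : ℝ} (γ : Icc a b → ℂ) (t₀ : Icc a b) :
    (n : ℕ) → NormalFormData a b n → ℂ → ℂ
  | 0, c, _ => c
  | m + 1, (c, μ), z =>
      ∑ j : Fin (m + 1), c j / (γ t₀ - z) ^ (j : ℕ) + cintegral μ (fun t => 1 / (γ t - z) ^ (m + 1))

/-- `d` is a simple `n`-normal form of `f` with base point `γ t₀`. -/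
def IsSimpleNormalForm {a b : ℝ} (γ : Icc a b → ℂ) (f : OnePoint ℂ → ℂ) (n : ℕ) (t₀ : Icc a b)
    (d : NormalFormData a b n) : Prop :=
  ∀ z : ℂ, z ∉ range γ → f (z : OnePoint ℂ) = normalFormFun γ t₀ n d z

end LipCurve

end

noncomputable section

open MeasureTheory Set Filter Topology
open scoped NNReal

namespace LipCurve

/-! Existence. Let `f` have growth order `N`, let `g = f - f(∞)`, and let `p = γ t₀`. The inverse of
`γ` extends to a Lipschitz map `τ : ℂ → [a, b]` that equals `t₀` far out, so `r = γ ∘ τ` is a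
Lipschitz retraction of the plane onto `Γ`, equal to `p` near infinity. For `z` off `Γ` put `q = (r
- w) / (r - z)`. Then `q = 1` at `w = z`, `q` vanishes to first order on `Γ`, and `∂̄q = (w - z) ∂̄r
/ (r - z)²`. Hence `g q ^ (N + 1)` tends to zero at `Γ`, and the Cauchy–Pompeiu formula holds for it
across the null set `Γ` once it is multiplied by a cutoff `κ` (`cauchy_cutoff_retraction`). The
factor `w - z` in `∂̄q` cancels the Cauchy kernel and leaves the bounded density `g (r - w) ^ N ∂̄r`
against `1 / (r - z) ^ (N + 2)`; its push-forward under `τ` is the measure `μ`. Where `∂̄κ` lives,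
`r = p`, and a finite geometric sum yields the poles at `p`; what remains tends to zero as `κ` is
pushed to infinity (`exists_cauchy_representation`).

Uniqueness. Take the difference of two normal forms. Its integral decays like `|z| ^ (-m - 1)`, so
after multiplication by `(p - z) ^ m` the coefficients form a polynomial tending to zero, and they
vanish (`eq_zero_of_sum_div_pow`). A retract of the plane does not separate it
(`isPreconnected_compl_of_retract`), so the remaining integral can be integrated in `z` from order
`m + 1` down to order one, the constants being fixed by decay at infinity. A measure whose Cauchy
transform vanishes off a null set annihilates every test function, by Cauchy–Pompeiu and Fubini
(`integral_comp_mul_eq_zero`), so it is zero. -/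

/-! ### Functions that are Lipschitz near a point -/

/-- `f` is Lipschitz on a neighbourhood of `x`. -/
def LipAt {X Y : Type*} [PseudoEMetricSpace X] [PseudoEMetricSpace Y] (f : X → Y) (x : X) : Prop :=
  ∃ K : ℝ≥0, ∃ s ∈ 𝓝 x, LipschitzOnWith K f s

section LipAt

variable {X Y Z : Type*} [PseudoEMetricSpace X] [PseudoEMetricSpace Y] [PseudoEMetricSpace Z]

theorem LipAt.of_lipschitzWith {f : X → Y} {K : ℝ≥0} (hf : LipschitzWith K f) (x : X) :
    LipAt f x := ⟨K, univ, univ_mem, hf.lipschitzOnWith⟩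

theorem LipAt.continuousAt {f : X → Y} {x : X} (hf : LipAt f x) : ContinuousAt f x := by
  obtain ⟨K, s, hs, h⟩ := hf
  exact h.continuousOn.continuousAt hs

theorem LipAt.comp {g : Y → Z} {f : X → Y} {x : X} (hg : LipAt g (f x)) (hf : LipAt f x) :
    LipAt (fun y => g (f y)) x := by
  have hc := hf.continuousAt
  obtain ⟨K, s, hs, h⟩ := hf
  obtain ⟨L, t, ht, h'⟩ := hg
  exact ⟨L * K, s ∩ f ⁻¹' t, inter_mem hs (hc ht),
    h'.comp (h.mono inter_subset_left) (fun y hy => hy.2)⟩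

theorem LipAt.congr {f g : X → Y} {x : X} (hf : LipAt f x) (h : f =ᶠ[𝓝 x] g) : LipAt g x := by
  obtain ⟨K, s, hs, hK⟩ := hf
  refine ⟨K, s ∩ {y | f y = g y}, inter_mem hs h, ?_⟩
  intro y hy z hz
  rw [← hy.2, ← hz.2]
  exact hK hy.1 hz.1

theorem LipAt.prodMk {f : X → Y} {g : X → Z} {x : X} (hf : LipAt f x) (hg : LipAt g x) :
    LipAt (fun y => (f y, g y)) x := by
  obtain ⟨K, s, hs, h⟩ := hf
  obtain ⟨L, t, ht, h'⟩ := hg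
  exact ⟨max K L, s ∩ t, inter_mem hs ht,
    (h.mono inter_subset_left).prodMk (h'.mono inter_subset_right)⟩

end LipAt

theorem LipAt.of_contDiffAt {E F : Type*} [NormedAddCommGroup E] [NormedSpace ℝ E]
    [NormedAddCommGroup F] [NormedSpace ℝ F] {f : E → F} {x : E} (hf : ContDiffAt ℝ 1 f x) :
    LipAt f x := hf.exists_lipschitzOnWith

section LipAtField

variable {X : Type*} [PseudoEMetricSpace X] {f g : X → ℂ} {x : X}

theorem LipAt.mul (hf : LipAt f x) (hg : LipAt g x) : LipAt (fun y => f y * g y) x := by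
  have h : ContDiffAt ℝ 1 (fun p : ℂ × ℂ => p.1 * p.2) (f x, g x) :=
    contDiffAt_fst.mul contDiffAt_snd
  exact (LipAt.of_contDiffAt h).comp (f := fun y => (f y, g y)) (hf.prodMk hg)

theorem LipAt.sub (hf : LipAt f x) (hg : LipAt g x) : LipAt (fun y => f y - g y) x := by
  have h : ContDiffAt ℝ 1 (fun p : ℂ × ℂ => p.1 - p.2) (f x, g x) :=
    contDiffAt_fst.sub contDiffAt_snd
  exact (LipAt.of_contDiffAt h).comp (f := fun y => (f y, g y)) (hf.prodMk hg)

theorem LipAt.div (hf : LipAt f x) (hg : LipAt g x) (h0 : g x ≠ 0) :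
    LipAt (fun y => f y / g y) x := by
  have h : ContDiffAt ℂ 1 (fun p : ℂ × ℂ => p.1 / p.2) (f x, g x) :=
    contDiffAt_fst.div contDiffAt_snd h0
  exact (LipAt.of_contDiffAt (h.restrict_scalars ℝ)).comp (f := fun y => (f y, g y))
    (hf.prodMk hg)

theorem LipAt.pow (hf : LipAt f x) (n : ℕ) : LipAt (fun y => f y ^ n) x :=
  LipAt.comp (g := fun w : ℂ => w ^ n) (LipAt.of_contDiffAt (contDiff_id.pow n).contDiffAt) hf

theorem LipAt.ofReal {f : X → ℝ} (hf : LipAt f x) : LipAt (fun y => (f y : ℂ)) x :=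
  LipAt.comp (g := fun t : ℝ => (t : ℂ)) (LipAt.of_contDiffAt Complex.ofRealCLM.contDiff.contDiffAt)
    hf

end LipAtField

theorem lipAt_const {X Y : Type*} [PseudoEMetricSpace X] [PseudoEMetricSpace Y] (c : Y) (x : X) :
    LipAt (fun _ : X => c) x := LipAt.of_lipschitzWith (LipschitzWith.const c) x

theorem lipAt_id {X : Type*} [PseudoEMetricSpace X] (x : X) :
    LipAt (fun y : X => y) x := LipAt.of_lipschitzWith LipschitzWith.id x

/-- A locally Lipschitz function with compact support is Lipschitz. -/
theorem exists_lipschitzWith_of_lipAt {F : ℂ → ℂ} (hF : ∀ x, LipAt F x)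
    (hc : HasCompactSupport F) : ∃ K, LipschitzWith K F := by
  obtain ⟨R, hR⟩ := hc.isCompact.isBounded.subset_closedBall (0 : ℂ)
  have hz : ∀ w, w ∉ Metric.closedBall (0 : ℂ) R → F w = 0 := fun w hw =>
    image_eq_zero_of_notMem_tsupport fun h => hw (hR h)
  obtain ⟨K, hK⟩ := LocallyLipschitzOn.exists_lipschitzOnWith_of_compact
    (isCompact_closedBall (0 : ℂ) (R + 1))
    (LocallyLipschitz.locallyLipschitzOn (s := Metric.closedBall (0 : ℂ) (R + 1)) hF)
  have hcont : Continuous F := continuous_iff_continuousAt.2 fun x => (hF x).continuousAt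
  obtain ⟨M, hM⟩ := hcont.bounded_above_of_compact_support hc
  have hM0 : 0 ≤ M := (norm_nonneg _).trans (hM 0)
  -- The support lies in the ball of radius `R`, so a point beyond `R + 1` is at distance at least
  -- one from it, and the sup bound `M` serves as a Lipschitz constant.
  have key : ∀ x y, y ∉ Metric.closedBall (0 : ℂ) (R + 1) → ‖F x - F y‖ ≤ M * ‖x - y‖ := by
    intro x y hy
    have hy' : R + 1 < ‖y‖ := by simpa using hy
    have hyR : y ∉ Metric.closedBall (0 : ℂ) R := by
      simp only [Metric.mem_closedBall, dist_zero_right, not_le]; linarith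
    rw [hz y hyR, sub_zero]
    by_cases hx : x ∈ Metric.closedBall (0 : ℂ) R
    · have hx' : ‖x‖ ≤ R := by simpa using hx
      have : 1 ≤ ‖x - y‖ := by
        have := norm_sub_norm_le y x
        rw [norm_sub_rev] at this; linarith
      nlinarith [hM x]
    · rw [hz x hx, norm_zero]; positivity
  refine ⟨max K ⟨M, hM0⟩, LipschitzWith.of_dist_le_mul fun x y => ?_⟩
  have h1 : (K : ℝ) ≤ (max K ⟨M, hM0⟩ : ℝ≥0) := by exact_mod_cast le_max_left _ _
  have h2 : M ≤ (max K ⟨M, hM0⟩ : ℝ≥0) := by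
    exact_mod_cast (le_max_right K (⟨M, hM0⟩ : ℝ≥0))
  by_cases hy : y ∈ Metric.closedBall (0 : ℂ) (R + 1)
  · by_cases hx : x ∈ Metric.closedBall (0 : ℂ) (R + 1)
    · exact (hK.dist_le_mul x hx y hy).trans (by gcongr)
    · rw [dist_comm (F x), dist_comm x, dist_eq_norm, dist_eq_norm]
      exact (key y x hx).trans (by gcongr)
  · rw [dist_eq_norm, dist_eq_norm]
    exact (key x y hy).trans (by gcongr)

/-! ### The Cauchy–Riemann operator -/

/-- The Cauchy–Riemann operator `∂/∂z̄`. -/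
def dbar (F : ℂ → ℂ) (w : ℂ) : ℂ :=
  (fderiv ℝ F w 1 + Complex.I * fderiv ℝ F w Complex.I) / 2

theorem measurable_dbar (F : ℂ → ℂ) : Measurable (dbar F) :=
  ((measurable_fderiv_apply_const ℝ F 1).add
    ((measurable_fderiv_apply_const ℝ F Complex.I).const_mul _)).div_const _

theorem dbar_congr {F G : ℂ → ℂ} {w : ℂ} (h : F =ᶠ[𝓝 w] G) : dbar F w = dbar G w := by
  simp only [dbar, h.fderiv_eq]

theorem dbar_const (c w : ℂ) : dbar (fun _ => c) w = 0 := by simp [dbar]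

theorem dbar_mul {F G : ℂ → ℂ} {w : ℂ} (hF : DifferentiableAt ℝ F w)
    (hG : DifferentiableAt ℝ G w) :
    dbar (fun z => F z * G z) w = dbar F w * G w + F w * dbar G w := by
  simp only [dbar, fderiv_fun_mul hF hG, add_apply,
    smul_apply, smul_eq_mul]
  ring

theorem dbar_comp {F φ : ℂ → ℂ} {w φ' : ℂ} (hφ : HasDerivAt φ φ' (F w))
    (hF : DifferentiableAt ℝ F w) : dbar (fun z => φ (F z)) w = φ' * dbar F w := by
  have h := (hφ.hasFDerivAt.restrictScalars ℝ).comp w hF.hasFDerivAt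
  simp only [dbar]
  rw [show (fun z => φ (F z)) = φ ∘ F from rfl, h.fderiv]
  simp
  ring

theorem dbar_id (w : ℂ) : dbar (fun z => z) w = 0 := by
  simp [dbar]

theorem dbar_eq_zero {F : ℂ → ℂ} {w : ℂ} (hF : DifferentiableAt ℂ F w) : dbar F w = 0 := by
  have := dbar_comp (F := fun z => z) hF.hasDerivAt differentiableAt_id
  rwa [dbar_id, mul_zero] at this

theorem dbar_conj (w : ℂ) : dbar (fun z => (starRingEnd ℂ) z) w = 1 := by
  have : fderiv ℝ (fun z : ℂ => (starRingEnd ℂ) z) w = Complex.conjCLE.toContinuousLinearMap :=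
    Complex.conjCLE.toContinuousLinearMap.hasFDerivAt.fderiv
  simp [dbar, this]

theorem norm_dbar_le_of_norm_fderiv {F : ℂ → ℂ} {w : ℂ} {K : ℝ} (h : ‖fderiv ℝ F w‖ ≤ K) :
    ‖dbar F w‖ ≤ K := by
  have h1 := ((fderiv ℝ F w).le_opNorm 1).trans (by simpa using h)
  have h2 := ((fderiv ℝ F w).le_opNorm Complex.I).trans (by simpa using h)
  have : ‖fderiv ℝ F w 1 + Complex.I * fderiv ℝ F w Complex.I‖ ≤ K + K := by
    refine (norm_add_le _ _).trans (add_le_add h1 ?_)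
    simpa using h2
  rw [dbar, norm_div, Complex.norm_two]
  linarith

theorem norm_dbar_le {F : ℂ → ℂ} {K : ℝ≥0} (hF : LipschitzWith K F) (w : ℂ) : ‖dbar F w‖ ≤ K :=
  norm_dbar_le_of_norm_fderiv (norm_fderiv_le_of_lipschitz ℝ hF)

theorem dbar_eq_zero_of_notMem_tsupport {F : ℂ → ℂ} {w : ℂ} (h : w ∉ tsupport F) :
    dbar F w = 0 := by
  rw [dbar_congr (notMem_tsupport_iff_eventuallyEq.1 h)]
  exact dbar_const 0 w

/-- Integration by parts against the constant function one; Rademacher's theorem identifies line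
derivatives with the Fréchet derivative almost everywhere. -/
theorem integral_fderiv_real_eq_zero {F : ℂ → ℝ} {K : ℝ≥0} (hF : LipschitzWith K F)
    (hc : HasCompactSupport F) (v : ℂ) : ∫ w, fderiv ℝ F w v = 0 := by
  have h := LipschitzWith.integral_lineDeriv_mul_eq (μ := (volume : Measure ℂ))
    (LipschitzWith.const (1 : ℝ) : LipschitzWith 0 fun _ : ℂ => (1 : ℝ)) hF hc (-v)
  have h0 : ∀ x : ℂ, lineDeriv ℝ (fun _ : ℂ => (1 : ℝ)) x (-v) = 0 := fun x => by
    simp [lineDeriv]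
  simp only [h0, zero_mul, integral_zero, neg_neg, mul_one] at h
  rw [h]
  refine integral_congr_ae ?_
  filter_upwards [hF.ae_differentiableAt (μ := volume)] with w hw
  exact (hw.lineDeriv_eq_fderiv).symm

theorem integrable_of_norm_le {F : ℂ → ℂ} {K : Set ℂ} {M : ℝ} (hm : AEStronglyMeasurable F)
    (hK : IsCompact K) (h0 : ∀ᵐ w, w ∉ K → F w = 0) (hM : ∀ᵐ w, ‖F w‖ ≤ M) : Integrable F := by
  have : Integrable (K.indicator fun _ : ℂ => |M|) :=
    (integrable_indicator_iff hK.measurableSet).2 (integrableOn_const hK.measure_lt_top.ne)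
  refine this.mono' hm ?_
  filter_upwards [h0, hM] with w h1 h2
  by_cases hw : w ∈ K
  · simpa [hw] using h2.trans (le_abs_self M)
  · simp [hw, h1 hw]

theorem integral_dbar_eq_zero {F : ℂ → ℂ} (hF : ∀ x, LipAt F x)
    (hc : HasCompactSupport F) : ∫ w, dbar F w = 0 := by
  obtain ⟨K, hK⟩ := exists_lipschitzWith_of_lipAt hF hc
  have hre : LipschitzWith K (fun w => (F w).re) := by
    refine LipschitzWith.of_dist_le_mul fun x y => ?_
    rw [Real.dist_eq, ← Complex.sub_re]
    exact (Complex.abs_re_le_norm _).trans (by simpa [dist_eq_norm] using hK.dist_le_mul x y)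
  have him : LipschitzWith K (fun w => (F w).im) := by
    refine LipschitzWith.of_dist_le_mul fun x y => ?_
    rw [Real.dist_eq, ← Complex.sub_im]
    exact (Complex.abs_im_le_norm _).trans (by simpa [dist_eq_norm] using hK.dist_le_mul x y)
  have hcre : HasCompactSupport (fun w => (F w).re) := hc.comp_left (g := Complex.re) rfl
  have hcim : HasCompactSupport (fun w => (F w).im) := hc.comp_left (g := Complex.im) rfl
  have hint : ∀ v, Integrable (fun w => fderiv ℝ F w v) := by
    intro v
    refine integrable_of_norm_le (M := K * ‖v‖)
      (measurable_fderiv_apply_const ℝ F v).aestronglyMeasurable hc.isCompact ?_ ?_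
    · refine Eventually.of_forall fun w hw => ?_
      rw [(notMem_tsupport_iff_eventuallyEq.1 hw).fderiv_eq]
      simp
    · refine Eventually.of_forall fun w => ((fderiv ℝ F w).le_opNorm v).trans ?_
      gcongr
      exact norm_fderiv_le_of_lipschitz ℝ hK
  have hz : ∀ v, ∫ w, fderiv ℝ F w v = 0 := by
    intro v
    have e : ∀ᵐ w, fderiv ℝ F w v = ((fderiv ℝ (fun w => (F w).re) w v : ℝ) : ℂ) +
        ((fderiv ℝ (fun w => (F w).im) w v : ℝ) : ℂ) * Complex.I := by
      filter_upwards [hK.ae_differentiableAt (μ := volume)] with w hw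
      have h1 : fderiv ℝ (fun w => (F w).re) w = Complex.reCLM.comp (fderiv ℝ F w) :=
        (Complex.reCLM.hasFDerivAt.comp w hw.hasFDerivAt).fderiv
      have h2 : fderiv ℝ (fun w => (F w).im) w = Complex.imCLM.comp (fderiv ℝ F w) :=
        (Complex.imCLM.hasFDerivAt.comp w hw.hasFDerivAt).fderiv
      rw [h1, h2]
      simp
    apply Complex.ext
    · have h1 : (∫ w, fderiv ℝ F w v).re = ∫ w, (fderiv ℝ F w v).re :=
        (Complex.reCLM.integral_comp_comm (hint v)).symm
      rw [h1, Complex.zero_re, ← integral_fderiv_real_eq_zero hre hcre v]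
      refine integral_congr_ae ?_
      filter_upwards [e] with w hw
      rw [hw]; simp
    · have h1 : (∫ w, fderiv ℝ F w v).im = ∫ w, (fderiv ℝ F w v).im :=
        (Complex.imCLM.integral_comp_comm (hint v)).symm
      rw [h1, Complex.zero_im, ← integral_fderiv_real_eq_zero him hcim v]
      refine integral_congr_ae ?_
      filter_upwards [e] with w hw
      rw [hw]; simp
  simp only [dbar]
  rw [integral_div, integral_add (hint 1) ((hint Complex.I).const_mul _), integral_const_mul,
    hz, hz]
  simp

/-! ### The Cauchy–Pompeiu formula -/

/-- The singular part `1 / |w|` on the unit disc. -/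
def diskKernel (w : ℂ) : ℝ := (Iio (1 : ℝ)).indicator (fun y => y⁻¹) ‖w‖

theorem diskKernel_nonneg (w : ℂ) : 0 ≤ diskKernel w := by
  unfold diskKernel
  by_cases hw : ‖w‖ ∈ Iio (1 : ℝ)
  · rw [indicator_of_mem hw]; positivity
  · rw [indicator_of_notMem hw]

/-- In polar coordinates the Jacobian `y` cancels the singularity `1 / y`. -/
theorem integrable_diskKernel : Integrable diskKernel := by
  unfold diskKernel
  rw [integrable_fun_norm_addHaar (μ := (volume : Measure ℂ))
    (f := (Iio (1 : ℝ)).indicator (fun y => y⁻¹))]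
  have h1 : IntegrableOn (fun _ : ℝ => (1 : ℝ)) (Ioo 0 1) := by
    simp
  have h2 : IntegrableOn ((Iio (1 : ℝ)).indicator fun _ : ℝ => (1 : ℝ)) (Ioi 0) := by
    rw [IntegrableOn, integrable_indicator_iff measurableSet_Iio, IntegrableOn,
      Measure.restrict_restrict measurableSet_Iio, inter_comm, Ioi_inter_Iio]
    exact h1
  refine h2.congr_fun (fun y hy => ?_) measurableSet_Ioi
  have hy' : y ≠ 0 := (mem_Ioi.1 hy).ne'
  by_cases h : y ∈ Iio (1 : ℝ)
  · simp only [indicator_of_mem h, Complex.finrank_real_complex, smul_eq_mul]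
    field_simp
    norm_num
  · simp [indicator_of_notMem h]

/-- An integrable majorant of `F w / (w - z)` for functions `F` bounded by `M` and supported
in `K`. -/
def kernelBound (M : ℝ) (K : Set ℂ) (z w : ℂ) : ℝ :=
  M * diskKernel (w - z) + K.indicator (fun _ => M) w

theorem integrable_kernelBound (M : ℝ) {K : Set ℂ} (hK : IsCompact K) (z : ℂ) :
    Integrable (kernelBound M K z) :=
  ((integrable_diskKernel.comp_sub_right z).const_mul M).add
    ((integrable_indicator_iff hK.measurableSet).2 (integrableOn_const hK.measure_lt_top.ne))

/-- By translation invariance the value does not depend on `z`; this uniformity is what Fubini needs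
in the uniqueness proof. -/
theorem integral_kernelBound (M : ℝ) {K : Set ℂ} (hK : IsCompact K) (z : ℂ) :
    ∫ w, kernelBound M K z w = M * (∫ w, diskKernel w) + ∫ w, K.indicator (fun _ => M) w := by
  unfold kernelBound
  rw [integral_add ((integrable_diskKernel.comp_sub_right z).const_mul M)
    ((integrable_indicator_iff hK.measurableSet).2 (integrableOn_const hK.measure_lt_top.ne)),
    integral_const_mul, integral_sub_right_eq_self (fun w => diskKernel w) z]

/-- Within distance one of `z` the disc kernel dominates; farther out the Cauchy kernel is at most
one and the indicator of `K` suffices. -/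
theorem norm_mul_le_kernelBound {M : ℝ} {K : Set ℂ} {z w c k : ℂ} (hM : ‖c‖ ≤ M)
    (hk : ‖k‖ ≤ ‖w - z‖⁻¹) (h0 : w ∉ K → c = 0) : ‖c * k‖ ≤ kernelBound M K z w := by
  have hM0 : 0 ≤ M := (norm_nonneg _).trans hM
  have hd := mul_nonneg hM0 (diskKernel_nonneg (w - z))
  unfold kernelBound
  by_cases hw : w ∈ K
  · rw [indicator_of_mem hw, norm_mul]
    by_cases h1 : ‖w - z‖ < 1
    · have : diskKernel (w - z) = ‖w - z‖⁻¹ := indicator_of_mem (mem_Iio.2 h1) _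
      rw [this]
      have : ‖c‖ * ‖k‖ ≤ M * ‖w - z‖⁻¹ := by gcongr
      linarith
    · have h2 : ‖w - z‖⁻¹ ≤ 1 := inv_le_one_of_one_le₀ (not_lt.1 h1)
      have : ‖c‖ * ‖k‖ ≤ M * 1 := by gcongr; exact hk.trans h2
      linarith
  · rw [h0 hw, indicator_of_notMem hw]
    simpa using hd

/-- The Cauchy kernel `1 / w`, regularized on the disc of radius `ε`. -/
def regKernel (ε : ℝ) (w : ℂ) : ℂ := (starRingEnd ℂ) w / ((max (‖w‖ ^ 2) (ε ^ 2) : ℝ) : ℂ)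

theorem regKernel_of_le {ε : ℝ} {w : ℂ} (hε : 0 < ε) (h : ε ≤ ‖w‖) : regKernel ε w = w⁻¹ := by
  have hw : w ≠ 0 := norm_pos_iff.1 (hε.trans_le h)
  rw [regKernel, max_eq_left (by gcongr), ← Complex.normSq_eq_norm_sq, Complex.normSq_eq_conj_mul_self]
  have : (starRingEnd ℂ) w ≠ 0 := by simpa using hw
  field_simp

theorem regKernel_of_ge {ε : ℝ} {w : ℂ} (h : ‖w‖ ≤ ε) :
    regKernel ε w = (starRingEnd ℂ) w * ((ε : ℂ) ^ 2)⁻¹ := by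
  rw [regKernel, max_eq_right (by gcongr), div_eq_mul_inv]
  push_cast
  rfl

theorem norm_regKernel_le (ε : ℝ) (w : ℂ) : ‖regKernel ε w‖ ≤ ‖w‖⁻¹ := by
  rcases eq_or_ne w 0 with rfl | hw
  · simp [regKernel]
  · have h0 : 0 < ‖w‖ := norm_pos_iff.2 hw
    rw [regKernel, norm_div, RCLike.norm_conj, Complex.norm_real, Real.norm_eq_abs,
      abs_of_pos (lt_max_of_lt_left (by positivity)), inv_eq_one_div,
      div_le_div_iff₀ (lt_max_of_lt_left (by positivity)) h0]
    nlinarith [le_max_left (‖w‖ ^ 2) (ε ^ 2)]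

theorem lipAt_regKernel {ε : ℝ} (hε : 0 < ε) (w : ℂ) : LipAt (regKernel ε) w := by
  have h1 : LipAt (fun w : ℂ => (starRingEnd ℂ) w) w :=
    LipAt.of_contDiffAt Complex.conjCLE.contDiff.contDiffAt
  have h2 : LipAt (fun w : ℂ => max (‖w‖ ^ 2) (ε ^ 2)) w := by
    have h3 : LipAt (fun w : ℂ => ‖w‖ ^ 2) w :=
      LipAt.of_contDiffAt (contDiff_norm_sq ℝ).contDiffAt
    have h4 : LipschitzWith 1 (fun t : ℝ => max t (ε ^ 2)) := by
      simpa using LipschitzWith.id.max_const (ε ^ 2)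
    exact (LipAt.of_lipschitzWith h4 _).comp h3
  refine h1.div h2.ofReal ?_
  have : 0 < max (‖w‖ ^ 2) (ε ^ 2) := lt_max_of_lt_right (by positivity)
  exact_mod_cast this.ne'

theorem continuous_regKernel {ε : ℝ} (hε : 0 < ε) : Continuous (regKernel ε) :=
  continuous_iff_continuousAt.2 fun w => (lipAt_regKernel hε w).continuousAt

/-- Inside the disc the kernel is `conj w / ε²`, outside it is the holomorphic `1 / w`. Only the
circle between them, a null set, is excluded. -/
theorem differentiableAt_regKernel {ε : ℝ} {w : ℂ} (hε : 0 < ε) (hw : ‖w‖ ≠ ε) :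
    DifferentiableAt ℝ (regKernel ε) w ∧
      dbar (regKernel ε) w = (Metric.ball 0 ε).indicator (fun _ => ((ε : ℂ) ^ 2)⁻¹) w := by
  rcases lt_or_gt_of_ne hw with h | h
  · have e : (fun w => (starRingEnd ℂ) w * ((ε : ℂ) ^ 2)⁻¹) =ᶠ[𝓝 w] regKernel ε := by
      filter_upwards [(isOpen_lt continuous_norm continuous_const).mem_nhds h] with v hv
      exact (regKernel_of_ge (le_of_lt hv)).symm
    have hd : DifferentiableAt ℝ (fun w : ℂ => (starRingEnd ℂ) w) w :=
      Complex.conjCLE.differentiableAt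
    refine ⟨(hd.mul_const _).congr_of_eventuallyEq e.symm, ?_⟩
    rw [← dbar_congr e, dbar_mul hd (differentiableAt_const _), dbar_conj, dbar_const,
      indicator_of_mem (by simpa using h)]
    ring
  · have e : (fun w => w⁻¹) =ᶠ[𝓝 w] regKernel ε := by
      filter_upwards [(isOpen_lt continuous_const continuous_norm).mem_nhds h] with v hv
      exact (regKernel_of_le hε (le_of_lt hv)).symm
    have hd : DifferentiableAt ℂ (fun w : ℂ => w⁻¹) w :=
      differentiableAt_inv (norm_pos_iff.1 (hε.trans h))
    refine ⟨(hd.restrictScalars ℝ).congr_of_eventuallyEq e.symm, ?_⟩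
    rw [← dbar_congr e, dbar_eq_zero hd, indicator_of_notMem (by simpa using h.le)]

/-- The product of `F` with the regularized kernel is Lipschitz of compact support, so the integral
of its `∂̄` is zero; the product rule gives the two terms. -/
theorem integral_dbar_mul_regKernel {F : ℂ → ℂ} (hF : ∀ x, LipAt F x)
    (hc : HasCompactSupport F) (z : ℂ) {ε : ℝ} (hε : 0 < ε) :
    ∫ w, dbar F w * regKernel ε (w - z) = -(((ε : ℂ) ^ 2)⁻¹ * ∫ w in Metric.ball z ε, F w) := by
  obtain ⟨K, hK⟩ := exists_lipschitzWith_of_lipAt hF hc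
  have hk : Continuous fun w => regKernel ε (w - z) := by
    have := continuous_regKernel hε
    fun_prop
  have hprod := integral_dbar_eq_zero (F := fun w => F w * regKernel ε (w - z))
    (fun x => (hF x).mul ((lipAt_regKernel hε (x - z)).comp (f := fun y => y - z)
      ((lipAt_id x).sub (lipAt_const z x))))
    hc.mul_right
  have hae : ∀ᵐ w : ℂ, ‖w - z‖ ≠ ε := by
    have : volume (Metric.sphere z ε) = 0 := Measure.addHaar_sphere_of_ne_zero _ _ hε.ne'
    filter_upwards [measure_eq_zero_iff_ae_notMem.1 this] with w hw h
    exact hw (by rwa [mem_sphere_iff_norm])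
  have hi1 : Integrable fun w => dbar F w * regKernel ε (w - z) := by
    refine (integrable_kernelBound K hc.isCompact z).mono'
      ((measurable_dbar F).mul hk.measurable).aestronglyMeasurable (Eventually.of_forall fun w => ?_)
    exact norm_mul_le_kernelBound (norm_dbar_le hK w) (norm_regKernel_le ε _)
      dbar_eq_zero_of_notMem_tsupport
  have hi2 : Integrable fun w => (Metric.ball z ε).indicator (fun w => F w) w :=
    (hK.continuous.integrable_of_hasCompactSupport hc).indicator measurableSet_ball
  have e : ∀ᵐ w : ℂ, dbar (fun w => F w * regKernel ε (w - z)) w =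
      dbar F w * regKernel ε (w - z) +
        ((ε : ℂ) ^ 2)⁻¹ * (Metric.ball z ε).indicator (fun w => F w) w := by
    filter_upwards [hae, hK.ae_differentiableAt (μ := volume)] with w hw hFw
    obtain ⟨h1, h2⟩ := differentiableAt_regKernel hε hw
    have h3 : DifferentiableAt ℝ (fun w => regKernel ε (w - z)) w :=
      h1.comp w (differentiableAt_id.sub_const z)
    have h4 : dbar (fun w => regKernel ε (w - z)) w = dbar (regKernel ε) (w - z) := by
      simp only [dbar, fderiv_comp_sub]
    rw [dbar_mul hFw h3, h4, h2]
    by_cases hb : ‖w - z‖ < ε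
    · rw [indicator_of_mem (by simpa using hb), indicator_of_mem (by simpa [dist_eq_norm] using hb)]
      ring
    · rw [indicator_of_notMem (by simpa using hb),
        indicator_of_notMem (by simpa [dist_eq_norm] using hb)]
      ring
  rw [integral_congr_ae e, integral_add hi1 (hi2.const_mul _), integral_const_mul,
    integral_indicator measurableSet_ball] at hprod
  exact eq_neg_of_add_eq_zero_left hprod

/-- The disc has area `π ε²`, which explains the factor `π`; the Lipschitz bound makes the error at
most `K π ε`. -/
theorem tendsto_average_ball {F : ℂ → ℂ} {K : ℝ≥0} (hF : LipschitzWith K F) (z : ℂ) :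
    Tendsto (fun ε : ℝ => ((ε : ℂ) ^ 2)⁻¹ * ∫ w in Metric.ball z ε, F w) (𝓝[>] 0)
      (𝓝 (Real.pi * F z)) := by
  have hvol : ∀ ε : ℝ, 0 < ε → (volume : Measure ℂ).real (Metric.ball z ε) = ε ^ 2 * Real.pi := by
    intro ε hε
    rw [Measure.real, Complex.volume_ball, ENNReal.toReal_mul, ENNReal.toReal_pow,
      ENNReal.toReal_ofReal hε.le]
    rfl
  rw [tendsto_iff_norm_sub_tendsto_zero]
  refine squeeze_zero' (g := fun ε => K * Real.pi * ε) (Eventually.of_forall fun _ => norm_nonneg _)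
    ?_ ?_
  · filter_upwards [self_mem_nhdsWithin] with ε (hε : 0 < ε)
    have hne : (ε : ℂ) ≠ 0 := by exact_mod_cast hε.ne'
    have hi : IntegrableOn F (Metric.ball z ε) :=
      (hF.continuous.continuousOn.integrableOn_compact (isCompact_closedBall z ε)).mono_set
        Metric.ball_subset_closedBall
    have e' : ((ε : ℂ) ^ 2)⁻¹ * (∫ w in Metric.ball z ε, F w) - Real.pi * F z =
        ((ε : ℂ) ^ 2)⁻¹ * ∫ w in Metric.ball z ε, (F w - F z) := by
      rw [integral_sub hi (integrableOn_const measure_ball_lt_top.ne), setIntegral_const, hvol ε hε,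
        mul_sub]
      congr 1
      rw [Complex.real_smul]
      push_cast
      field_simp
    rw [e', norm_mul]
    have : ‖∫ w in Metric.ball z ε, (F w - F z)‖ ≤ (K * ε) * (ε ^ 2 * Real.pi) := by
      rw [← hvol ε hε]
      refine norm_setIntegral_le_of_norm_le_const measure_ball_lt_top fun w hw => ?_
      rw [← dist_eq_norm]
      refine (hF.dist_le_mul w z).trans ?_
      gcongr
      exact (Metric.mem_ball.1 hw).le
    calc _ ≤ ‖((ε : ℂ) ^ 2)⁻¹‖ * ((K * ε) * (ε ^ 2 * Real.pi)) := by gcongr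
      _ = K * Real.pi * ε := by
        rw [norm_inv, norm_pow, Complex.norm_real, Real.norm_eq_abs, abs_of_pos hε]
        field_simp
  · have : Tendsto (fun ε : ℝ => K * Real.pi * ε) (𝓝 0) (𝓝 (K * Real.pi * 0)) :=
      tendsto_id.const_mul _
    rw [mul_zero] at this
    exact this.mono_left nhdsWithin_le_nhds

/-- The Cauchy–Pompeiu formula for compactly supported Lipschitz functions. -/
theorem integral_dbar_div {F : ℂ → ℂ} (hF : ∀ x, LipAt F x)
    (hc : HasCompactSupport F) (z : ℂ) : ∫ w, dbar F w * (w - z)⁻¹ = -(Real.pi * F z) := by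
  obtain ⟨K, hK⟩ := exists_lipschitzWith_of_lipAt hF hc
  have h1 : Tendsto (fun ε : ℝ => ∫ w, dbar F w * regKernel ε (w - z)) (𝓝[>] 0)
      (𝓝 (∫ w, dbar F w * (w - z)⁻¹)) := by
    refine tendsto_integral_filter_of_dominated_convergence (kernelBound K (tsupport F) z) ?_ ?_
      (integrable_kernelBound K hc.isCompact z) ?_
    · filter_upwards [self_mem_nhdsWithin] with ε (hε : 0 < ε)
      have := continuous_regKernel hε
      exact ((measurable_dbar F).mul (by fun_prop : Continuous fun w => regKernel ε
        (w - z)).measurable).aestronglyMeasurable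
    · filter_upwards with ε
      filter_upwards with w
      exact norm_mul_le_kernelBound (norm_dbar_le hK w) (norm_regKernel_le ε _)
        dbar_eq_zero_of_notMem_tsupport
    · filter_upwards [Measure.ae_ne (μ := (volume : Measure ℂ)) z] with w hw
      have h0 : 0 < ‖w - z‖ := norm_pos_iff.2 (sub_ne_zero.2 hw)
      refine tendsto_const_nhds.congr' ?_
      filter_upwards [Ioo_mem_nhdsGT h0] with ε hε
      rw [regKernel_of_le hε.1 hε.2.le]
  have h2 := (tendsto_average_ball hK z).neg
  refine tendsto_nhds_unique h1 (h2.congr' ?_)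
  filter_upwards [self_mem_nhdsWithin] with ε (hε : 0 < ε)
  exact (integral_dbar_mul_regKernel hF hc z hε).symm

/-! ### A removable set in the Cauchy–Pompeiu formula -/

/-- The truncation of a real number to `[0, 1]`. -/
def ramp (x : ℝ) : ℝ := max 0 (min 1 x)

theorem lipschitzWith_ramp : LipschitzWith 1 ramp := by
  unfold ramp
  simpa using (LipschitzWith.id.const_min (1 : ℝ)).const_max (0 : ℝ)

theorem ramp_nonneg (x : ℝ) : 0 ≤ ramp x := le_max_left _ _

theorem ramp_le_one (x : ℝ) : ramp x ≤ 1 := max_le zero_le_one (min_le_left _ _)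

theorem ramp_of_nonpos {x : ℝ} (h : x ≤ 0) : ramp x = 0 :=
  max_eq_left ((min_le_right _ _).trans h)

theorem ramp_of_one_le {x : ℝ} (h : 1 ≤ x) : ramp x = 1 := by
  rw [ramp, min_eq_left h, max_eq_right zero_le_one]

theorem lipschitzWith_ramp_comp {d : ℂ → ℝ} (hd : LipschitzWith 1 d) (a b : ℝ) :
    LipschitzWith (Real.toNNReal |a|) (fun w => ((ramp (a * d w + b) : ℝ) : ℂ)) := by
  refine LipschitzWith.of_dist_le_mul fun x y => ?_
  have h1 := lipschitzWith_ramp.dist_le_mul (a * d x + b) (a * d y + b)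
  have h2 := hd.dist_le_mul x y
  rw [Real.coe_toNNReal _ (abs_nonneg a), Complex.dist_eq, ← Complex.ofReal_sub,
    Complex.norm_real, ← dist_eq_norm]
  refine h1.trans ?_
  have h3 : dist (a * d x + b) (a * d y + b) = |a| * dist (d x) (d y) := by
    rw [Real.dist_eq, Real.dist_eq, ← abs_mul]; congr 1; ring
  rw [h3]
  simp only [NNReal.coe_one, one_mul] at h2 ⊢
  gcongr

/-- Multiply `u` by a cutoff `θ ε` that is zero within `ε` of `Γ` and one beyond `2 * ε`. Its `∂̄`
is at most `1 / ε` and lives where `‖u‖ ≤ 2 * C * ε`, so the error term is bounded by `2 * C` and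
disappears by dominated convergence, `Γ` being null. -/
theorem integral_dbar_div_of_removable {Γ : Set ℂ} (hΓ : IsClosed Γ) (hne : Γ.Nonempty)
    (hnull : volume Γ = 0) {u : ℂ → ℂ} (hu : ∀ x ∉ Γ, LipAt u x) (hc : HasCompactSupport u)
    (hd : ∀ᵐ w, DifferentiableAt ℝ u w) {C B : ℝ} (hC0 : 0 ≤ C)
    (hC : ∀ w, ‖u w‖ ≤ C * Metric.infDist w Γ) (hB : ∀ᵐ w, ‖dbar u w‖ ≤ B) {z : ℂ}
    (hz : z ∉ Γ) : ∫ w, dbar u w * (w - z)⁻¹ = -(Real.pi * u z) := by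
  have hpos : ∀ w ∉ Γ, 0 < Metric.infDist w Γ := fun w hw =>
    (hΓ.notMem_iff_infDist_pos hne).1 hw
  have hdc : Continuous fun w => Metric.infDist w Γ := Metric.continuous_infDist_pt Γ
  set θ : ℝ → ℂ → ℂ := fun ε w => ((ramp (ε⁻¹ * Metric.infDist w Γ + -1) : ℝ) : ℂ) with hθ
  have hθlip : ∀ ε, LipschitzWith (Real.toNNReal |ε⁻¹|) (θ ε) := fun ε =>
    lipschitzWith_ramp_comp (Metric.lipschitz_infDist_pt Γ) _ _
  have hθ1 : ∀ ε : ℝ, 0 < ε → ∀ w, 2 * ε < Metric.infDist w Γ → θ ε =ᶠ[𝓝 w] fun _ => 1 := by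
    intro ε hε w hw
    filter_upwards [(isOpen_lt continuous_const hdc).mem_nhds hw] with v hv
    have hv' : 2 * ε < Metric.infDist v Γ := hv
    have : 1 ≤ ε⁻¹ * Metric.infDist v Γ + -1 := by
      have : 2 ≤ ε⁻¹ * Metric.infDist v Γ := by
        rw [← div_eq_inv_mul, le_div_iff₀ hε]; exact hv'.le
      linarith
    simp [hθ, ramp_of_one_le this]
  have hθn : ∀ ε w, ‖θ ε w‖ ≤ 1 := fun ε w => by
    simp only [hθ, Complex.norm_real, Real.norm_eq_abs, abs_of_nonneg (ramp_nonneg _)]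
    exact ramp_le_one _
  have hv : ∀ ε : ℝ, 0 < ε → ∀ x, LipAt (fun w => θ ε w * u w) x := by
    intro ε hε x
    by_cases hx : x ∈ Γ
    · refine (lipAt_const (0 : ℂ) x).congr ?_
      have h0 : Metric.infDist x Γ < ε := by
        rw [Metric.infDist_zero_of_mem hx]; exact hε
      filter_upwards [(isOpen_lt hdc continuous_const).mem_nhds h0] with v hv
      have hv' : Metric.infDist v Γ < ε := hv
      have : ε⁻¹ * Metric.infDist v Γ + -1 ≤ 0 := by
        have : ε⁻¹ * Metric.infDist v Γ ≤ 1 := by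
          rw [← div_eq_inv_mul, div_le_one hε]; exact hv'.le
        linarith
      simp [hθ, ramp_of_nonpos this]
    · exact (LipAt.of_lipschitzWith (hθlip ε) x).mul (hu x hx)
  have hae : ∀ᵐ w : ℂ, w ∉ Γ := measure_eq_zero_iff_ae_notMem.1 hnull
  have hB0 : 0 ≤ B := by
    obtain ⟨w, hw⟩ := hB.exists
    exact (norm_nonneg _).trans hw
  have h1 : Tendsto (fun ε : ℝ => ∫ w, dbar (fun w => θ ε w * u w) w * (w - z)⁻¹) (𝓝[>] 0)
      (𝓝 (∫ w, dbar u w * (w - z)⁻¹)) := by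
    refine tendsto_integral_filter_of_dominated_convergence
      (kernelBound (2 * C + B) (tsupport u) z) ?_ ?_ (integrable_kernelBound _ hc.isCompact z) ?_
    · filter_upwards with ε
      exact ((measurable_dbar _).mul (by fun_prop)).aestronglyMeasurable
    · filter_upwards [self_mem_nhdsWithin] with ε (hε : 0 < ε)
      filter_upwards [hd, hB, (hθlip ε).ae_differentiableAt (μ := volume)] with w h1 h2 h3
      refine norm_mul_le_kernelBound ?_ (norm_inv _).le fun hw => ?_
      · rw [dbar_mul h3 h1]
        refine (norm_add_le _ _).trans (add_le_add ?_ ?_)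
        · rw [norm_mul]
          by_cases hw : 2 * ε < Metric.infDist w Γ
          · rw [dbar_congr (hθ1 ε hε w hw), dbar_const, norm_zero, zero_mul]
            positivity
          · have h4 := norm_dbar_le (hθlip ε) w
            rw [Real.coe_toNNReal _ (abs_nonneg _), abs_of_pos (inv_pos.2 hε)] at h4
            calc _ ≤ ε⁻¹ * (C * (2 * ε)) :=
                  mul_le_mul h4 ((hC w).trans (by gcongr; exact not_lt.1 hw)) (norm_nonneg _)
                    (inv_pos.2 hε).le
              _ = 2 * C := by field_simp
        · rw [norm_mul]
          exact (mul_le_of_le_one_left (norm_nonneg _) (hθn ε w)).trans h2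
      · have := notMem_tsupport_iff_eventuallyEq.1 hw
        have h5 : (fun w => θ ε w * u w) =ᶠ[𝓝 w] fun _ => 0 := by
          filter_upwards [this] with v hv
          simp [hv]
        rw [dbar_congr h5, dbar_const]
    · filter_upwards [hae] with w hw
      refine tendsto_const_nhds.congr' ?_
      filter_upwards [Ioo_mem_nhdsGT (half_pos (hpos w hw))] with ε hε
      have : (fun w => θ ε w * u w) =ᶠ[𝓝 w] u := by
        filter_upwards [hθ1 ε hε.1 w (by linarith [hε.2])] with v hv
        rw [hv, one_mul]
      rw [dbar_congr this]
  refine tendsto_nhds_unique h1 (tendsto_const_nhds.congr' ?_)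
  filter_upwards [Ioo_mem_nhdsGT (half_pos (hpos z hz))] with ε hε
  rw [integral_dbar_div (hv ε hε.1) hc.mul_left z, (hθ1 ε hε.1 z (by linarith [hε.2])).eq_of_nhds,
    one_mul]

/-! ### Lipschitz arcs: area and Lipschitz retractions -/

/-- A Lipschitz image of the line has Hausdorff dimension at most one, while planar Lebesgue measure
is a multiple of two-dimensional Hausdorff measure. -/
theorem volume_range_eq_zero {a b : ℝ} (hab : a ≤ b) {γ : Icc a b → ℂ} {K : ℝ≥0}
    (hγ : LipschitzWith K γ) : volume (range γ) = 0 := by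
  have h1 : range γ = range (γ ∘ projIcc a b hab) :=
    ((projIcc_surjective hab).range_comp γ).symm
  have h2 : dimH (range γ) < ((2 : ℝ≥0) : ENNReal) := by
    rw [h1]
    refine ((hγ.comp (LipschitzWith.projIcc hab)).dimH_range_le).trans_lt ?_
    rw [Real.dimH_univ]
    norm_num
  have : (μH[((2 : ℝ≥0) : ℝ)] : Measure ℂ).IsAddHaarMeasure := by
    have h := isAddHaarMeasure_hausdorffMeasure (E := ℂ)
    rw [Complex.finrank_real_complex] at h
    exact_mod_cast h
  refine measure_zero_of_dimH_lt (d := 2) ?_ h2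
  rw [Measure.isAddLeftInvariant_eq_smul (volume : Measure ℂ) (μH[((2 : ℝ≥0) : ℝ)])]
  exact Measure.smul_absolutelyContinuous

/-- On `Γ` the inverse of `γ` is Lipschitz, and the far region, where the value `t₀` is prescribed,
is at distance at least one from `Γ`. The two prescriptions together are therefore Lipschitz; extend
the real-valued map to the plane and clamp it to `[a, b]`. The radius `R` serves all `t₀` at once.
-/
theorem exists_lipschitz_retraction {a b : ℝ} {γ : Icc a b → ℂ} {K L : ℝ≥0}
    (hγ : LipschitzWith K γ) (hγ' : AntilipschitzWith L γ) :
    ∃ R : ℝ, 0 < R ∧ range γ ⊆ Metric.ball 0 R ∧ ∀ t₀ : Icc a b, ∃ (τ : ℂ → Icc a b) (M : ℝ≥0),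
      LipschitzWith M τ ∧ (∀ t, τ (γ t) = t) ∧ ∀ w, R ≤ ‖w‖ → τ w = t₀ := by
  obtain ⟨R, hR⟩ := (isCompact_range hγ.continuous).isBounded.subset_closedBall (0 : ℂ)
  have hR' : ∀ t, ‖γ t‖ ≤ |R| := fun t => by
    have := hR (mem_range_self t)
    rw [mem_closedBall_zero_iff] at this
    exact this.trans (le_abs_self R)
  refine ⟨|R| + 1, by positivity, ?_, fun t₀ => ?_⟩
  · rintro _ ⟨t, rfl⟩
    rw [mem_ball_zero_iff]
    linarith [hR' t]
  have hab : a ≤ b := t₀.2.1.trans t₀.2.2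
  have : Nonempty (Icc a b) := ⟨t₀⟩
  have hinv : ∀ t, Function.invFun γ (γ t) = t := Function.leftInverse_invFun hγ'.injective
  classical
  let σ : ℂ → ℝ := fun w => if w ∈ range γ then (Function.invFun γ w : Icc a b) else (t₀ : ℝ)
  have hσ1 : ∀ t, σ (γ t) = t := fun t => by simp only [σ, if_pos (mem_range_self t), hinv]
  have hσ2 : ∀ w, |R| + 1 ≤ ‖w‖ → σ w = t₀ := fun w hw => by
    refine if_neg ?_
    rintro ⟨t, rfl⟩
    linarith [hR' t]
  let S : Set ℂ := range γ ∪ {w | |R| + 1 ≤ ‖w‖}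
  let M : ℝ≥0 := max L (Real.toNNReal (b - a))
  have hML : (L : ℝ) ≤ M := by exact_mod_cast le_max_left L _
  have hMab : b - a ≤ M := by
    have : (Real.toNNReal (b - a) : ℝ) ≤ M := by exact_mod_cast le_max_right L _
    rwa [Real.coe_toNNReal _ (sub_nonneg.2 hab)] at this
  have key : ∀ (t : Icc a b) (w : ℂ), |R| + 1 ≤ ‖w‖ → dist (t : ℝ) t₀ ≤ M * dist (γ t) w := by
    intro t w hw
    have h1 : dist (t : ℝ) t₀ ≤ b - a := Real.dist_le_of_mem_Icc t.2 t₀.2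
    have h2 : 1 ≤ dist (γ t) w := by
      have := norm_sub_norm_le w (γ t)
      rw [dist_comm, dist_eq_norm]
      linarith [hR' t]
    have h3 : (0 : ℝ) ≤ M := M.2
    nlinarith
  have hσ : LipschitzOnWith M σ S := by
    refine LipschitzOnWith.of_dist_le_mul ?_
    rintro x (⟨s, rfl⟩ | hx) y (⟨t, rfl⟩ | hy)
    · rw [hσ1, hσ1]
      exact (hγ'.le_mul_dist s t).trans (by gcongr)
    · rw [hσ1, hσ2 y hy]
      exact key s y hy
    · rw [hσ1, hσ2 x hx, dist_comm, dist_comm x]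
      exact key t x hx
    · rw [hσ2 x hx, hσ2 y hy, dist_self]
      positivity
  obtain ⟨ρ, hρ, hρσ⟩ := hσ.extend_real
  refine ⟨fun w => projIcc a b hab (ρ w), 1 * M, (LipschitzWith.projIcc hab).comp hρ, ?_, ?_⟩
  · intro t
    change projIcc a b hab (ρ (γ t)) = t
    rw [← hρσ (Or.inl (mem_range_self t)), hσ1, projIcc_val]
  · intro w hw
    change projIcc a b hab (ρ w) = t₀
    rw [← hρσ (Or.inr hw), hσ2 w hw, projIcc_val]

/-! ### The representation formula -/

/-- A Lipschitz cutoff function, equal to `1` on the disc of radius `S` and to `0` off the disc of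
radius `2 * S`. -/
def cutoff (S : ℝ) (w : ℂ) : ℂ := ((ramp (-S⁻¹ * ‖w‖ + 2) : ℝ) : ℂ)

section cutoff

variable {S : ℝ} {w : ℂ}

theorem lipschitzWith_cutoff (S : ℝ) : LipschitzWith (Real.toNNReal |-S⁻¹|) (cutoff S) :=
  lipschitzWith_ramp_comp lipschitzWith_one_norm _ _

theorem cutoff_of_le (hS : 0 < S) (h : ‖w‖ ≤ S) : cutoff S w = 1 := by
  have : S⁻¹ * ‖w‖ ≤ 1 := by rw [← div_eq_inv_mul, div_le_one hS]; exact h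
  rw [cutoff, ramp_of_one_le (by linarith), Complex.ofReal_one]

theorem cutoff_of_ge (hS : 0 < S) (h : 2 * S ≤ ‖w‖) : cutoff S w = 0 := by
  have : 2 ≤ S⁻¹ * ‖w‖ := by rw [← div_eq_inv_mul, le_div_iff₀ hS]; exact h
  rw [cutoff, ramp_of_nonpos (by linarith), Complex.ofReal_zero]

theorem norm_cutoff_le (S : ℝ) (w : ℂ) : ‖cutoff S w‖ ≤ 1 := by
  rw [cutoff, Complex.norm_real, Real.norm_eq_abs, abs_of_nonneg (ramp_nonneg _)]
  exact ramp_le_one _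

theorem cutoff_eventuallyEq_one (hS : 0 < S) (h : ‖w‖ < S) : cutoff S =ᶠ[𝓝 w] fun _ => 1 := by
  filter_upwards [(isOpen_lt continuous_norm continuous_const).mem_nhds h] with v hv
  exact cutoff_of_le hS (le_of_lt hv)

theorem dbar_cutoff_of_lt (hS : 0 < S) (h : ‖w‖ < S) : dbar (cutoff S) w = 0 := by
  rw [dbar_congr (cutoff_eventuallyEq_one hS h), dbar_const]

theorem dbar_cutoff_of_gt (hS : 0 < S) (h : 2 * S < ‖w‖) : dbar (cutoff S) w = 0 := by
  have : cutoff S =ᶠ[𝓝 w] fun _ => 0 := by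
    filter_upwards [(isOpen_lt continuous_const continuous_norm).mem_nhds h] with v hv
    exact cutoff_of_ge hS (le_of_lt hv)
  rw [dbar_congr this, dbar_const]

theorem norm_dbar_cutoff_le (hS : 0 < S) (w : ℂ) : ‖dbar (cutoff S) w‖ ≤ S⁻¹ := by
  have h := norm_dbar_le (lipschitzWith_cutoff S) w
  rwa [Real.coe_toNNReal _ (abs_nonneg _), abs_neg, abs_of_pos (inv_pos.2 hS)] at h

theorem hasCompactSupport_cutoff (hS : 0 < S) : HasCompactSupport (cutoff S) := by
  refine HasCompactSupport.intro (isCompact_closedBall (0 : ℂ) (2 * S)) fun w hw => ?_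
  refine cutoff_of_ge hS ?_
  rw [mem_closedBall_zero_iff, not_le] at hw
  exact hw.le

end cutoff

theorem lipAt_of_differentiableOn {g : ℂ → ℂ} {U : Set ℂ} (hU : IsOpen U)
    (hg : DifferentiableOn ℂ g U) {x : ℂ} (hx : x ∈ U) : LipAt g x :=
  LipAt.of_contDiffAt (((hg.analyticAt (hU.mem_nhds hx)).contDiffAt).restrict_scalars ℝ)

/-- Integrability of `g ∂̄κ φ` for the cutoff function `κ` and functions `g`, `φ` bounded on the
annulus on which `∂̄κ` lives. -/
theorem integrable_mul_dbar_cutoff {g φ : ℂ → ℂ} (hg : Measurable g) (hφ : Measurable φ) {S A B : ℝ}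
    (hS : 0 < S) (hA : ∀ w, S ≤ ‖w‖ → ‖g w‖ ≤ A) (hB : ∀ w, S ≤ ‖w‖ → ‖w‖ ≤ 2 * S → ‖φ w‖ ≤ B) :
    Integrable (fun w => g w * dbar (cutoff S) w * φ w) := by
  refine integrable_of_norm_le (M := |A| * S⁻¹ * |B|)
    ((hg.mul (measurable_dbar _)).mul hφ).aestronglyMeasurable
    (isCompact_closedBall (0 : ℂ) (2 * S)) (Eventually.of_forall fun w hw => ?_)
    (Eventually.of_forall fun w => ?_)
  · rw [mem_closedBall_zero_iff, not_le] at hw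
    rw [dbar_cutoff_of_gt hS hw]; ring
  · have h0 : 0 ≤ |A| * S⁻¹ * |B| := by positivity
    rcases lt_or_ge ‖w‖ S with h | h
    · rw [dbar_cutoff_of_lt hS h]; simpa using h0
    rcases lt_or_ge (2 * S) ‖w‖ with h' | h'
    · rw [dbar_cutoff_of_gt hS h']; simpa using h0
    rw [norm_mul, norm_mul]
    have h1 := (hA w h).trans (le_abs_self A)
    have h2 := (hB w h h').trans (le_abs_self B)
    have h3 := norm_dbar_cutoff_le hS w
    gcongr

section Representation

variable {Γ : Set ℂ} {g : ℂ → ℂ} {R A : ℝ} {p : ℂ}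

/-- The moments `∫ g ∂̄κ (p - w) ^ j` do not depend on the radius of the cutoff function `κ`. -/
theorem integral_dbar_cutoff_pow_eq (hΓ : IsClosed Γ) (hnull : volume Γ = 0)
    (hg : DifferentiableOn ℂ g Γᶜ) (hgm : Measurable g) (hΓR : Γ ⊆ Metric.ball 0 R)
    (hA : ∀ w, R ≤ ‖w‖ → ‖g w‖ ≤ A) {S T : ℝ} (hS0 : 0 < S) (hT0 : 0 < T)
    (hS : R ≤ S) (hT : R ≤ T) (j : ℕ) :
    ∫ w, g w * dbar (cutoff S) w * (p - w) ^ j = ∫ w, g w * dbar (cutoff T) w * (p - w) ^ j := by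
  have hint : ∀ S, 0 < S → R ≤ S →
      Integrable (fun w => g w * dbar (cutoff S) w * (p - w) ^ j) := by
    intro S hS0 hS
    refine integrable_mul_dbar_cutoff (A := A) (B := (‖p‖ + 2 * S) ^ j) hgm (by fun_prop) hS0
      (fun w hw => hA w (hS.trans hw)) fun w _ hw => ?_
    rw [norm_pow]
    gcongr
    exact (norm_sub_le _ _).trans (by gcongr)
  have hz := integral_dbar_eq_zero
    (F := fun w => (cutoff S w - cutoff T w) * (g w * (p - w) ^ j)) ?_ ?_
  · rw [← sub_eq_zero, ← integral_sub (hint S hS0 hS) (hint T hT0 hT), ← hz]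
    refine integral_congr_ae ?_
    filter_upwards [measure_eq_zero_iff_ae_notMem.1 hnull,
      (lipschitzWith_cutoff S).ae_differentiableAt (μ := volume),
      (lipschitzWith_cutoff T).ae_differentiableAt (μ := volume)] with w hw h1 h2
    have h3 : DifferentiableAt ℂ (fun w => g w * (p - w) ^ j) w :=
      (hg.differentiableAt (hΓ.isOpen_compl.mem_nhds hw)).mul (by fun_prop)
    have h4 : dbar (fun w => cutoff S w - cutoff T w) w =
        dbar (cutoff S) w - dbar (cutoff T) w := by
      simp only [dbar, fderiv_fun_sub h1 h2, sub_apply]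
      ring
    rw [dbar_mul (h1.fun_sub h2) (h3.restrictScalars ℝ), dbar_eq_zero h3, h4]
    ring
  · intro x
    by_cases hx : x ∈ Γ
    · refine (lipAt_const (0 : ℂ) x).congr ?_
      have hxR : ‖x‖ < R := by simpa using hΓR hx
      filter_upwards [cutoff_eventuallyEq_one hS0 (hxR.trans_le hS),
        cutoff_eventuallyEq_one hT0 (hxR.trans_le hT)] with v h1 h2
      rw [h1, h2, sub_self, zero_mul]
    · exact ((LipAt.of_lipschitzWith (lipschitzWith_cutoff S) x).sub
        (LipAt.of_lipschitzWith (lipschitzWith_cutoff T) x)).mul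
        ((lipAt_of_differentiableOn hΓ.isOpen_compl hg hx).mul
          (((lipAt_const p x).sub (lipAt_id x)).pow j))
  · exact ((hasCompactSupport_cutoff hS0).sub (hasCompactSupport_cutoff hT0)).mul_right

/-- The integrand is `O(S⁻³)`, one factor `S⁻¹` each from `g`, the cutoff and the kernel, on a disc
of area `O(S²)`. -/
theorem tendsto_integral_dbar_cutoff_div (hR : 0 < R)
    (hA : ∀ w, R ≤ ‖w‖ → ‖g w‖ ≤ A / ‖w‖) (z : ℂ) :
    Tendsto (fun S => ∫ w, g w * dbar (cutoff S) w * (w - z)⁻¹) atTop (𝓝 0) := by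
  have hA0 : 0 ≤ A := by
    have h := (norm_nonneg _).trans (hA R (by simp [abs_of_pos hR]))
    rw [Complex.norm_real, Real.norm_eq_abs, abs_of_pos hR] at h
    exact (div_nonneg_iff.1 h).elim And.left fun h => absurd hR (not_lt.2 h.2)
  rw [tendsto_zero_iff_norm_tendsto_zero]
  have hlim : Tendsto (fun S : ℝ => (8 * A * Real.pi) * S⁻¹) atTop (𝓝 0) := by
    simpa using tendsto_inv_atTop_zero.const_mul (8 * A * Real.pi)
  refine squeeze_zero' (Eventually.of_forall fun _ => norm_nonneg _) ?_ hlim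
  filter_upwards [eventually_ge_atTop R, eventually_ge_atTop (2 * ‖z‖)] with S hSR hSz
  have hS : 0 < S := hR.trans_le hSR
  have h0 : ∀ w ∉ Metric.closedBall (0 : ℂ) (2 * S),
      g w * dbar (cutoff S) w * (w - z)⁻¹ = 0 := by
    intro w hw
    rw [mem_closedBall_zero_iff, not_le] at hw
    rw [dbar_cutoff_of_gt hS hw]; ring
  rw [← setIntegral_eq_integral_of_forall_compl_eq_zero h0]
  have hb : ∀ w ∈ Metric.closedBall (0 : ℂ) (2 * S),
      ‖g w * dbar (cutoff S) w * (w - z)⁻¹‖ ≤ A / S * S⁻¹ * (S / 2)⁻¹ := by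
    intro w _
    rcases lt_or_ge ‖w‖ S with h | h
    · rw [dbar_cutoff_of_lt hS h, mul_zero, zero_mul, norm_zero]; positivity
    rw [norm_mul, norm_mul, norm_inv]
    have h1 : ‖g w‖ ≤ A / S := (hA w (hSR.trans h)).trans (by gcongr)
    have h2 := norm_dbar_cutoff_le hS w
    have h3 : S / 2 ≤ ‖w - z‖ := by
      have := norm_sub_norm_le w z
      linarith
    gcongr
  refine (norm_setIntegral_le_of_norm_le_const (measure_closedBall_lt_top) hb).trans ?_
  have hvol : (volume : Measure ℂ).real (Metric.closedBall 0 (2 * S)) = (2 * S) ^ 2 * Real.pi := by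
    rw [Measure.real, Complex.volume_closedBall, ENNReal.toReal_mul, ENNReal.toReal_pow,
      ENNReal.toReal_ofReal (by positivity)]
    rfl
  rw [hvol]
  apply le_of_eq
  field_simp
  ring

variable {r : ℂ → ℂ} {M : ℝ≥0} {N : ℕ}

/-- The density of the measure in the representation formula. -/
def reprDensity (g r : ℂ → ℂ) (N : ℕ) (w : ℂ) : ℂ :=
  -(((N + 1 : ℕ) : ℂ) / Real.pi) * (g w * (r w - w) ^ N * dbar r w)

/-- The map `r - id` vanishes on `Γ` and has Lipschitz constant `M + 1`. -/
theorem norm_retraction_sub_le (hne : Γ.Nonempty) (hr : LipschitzWith M r)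
    (hrΓ : ∀ w ∈ Γ, r w = w) (w : ℂ) : ‖r w - w‖ ≤ (M + 1) * Metric.infDist w Γ := by
  have hM : (0 : ℝ) < M + 1 := by positivity
  rw [mul_comm, ← div_le_iff₀ hM]
  refine (Metric.le_infDist hne).2 fun y hy => ?_
  rw [div_le_iff₀ hM, ← dist_eq_norm]
  have h1 := hr.dist_le_mul w y
  rw [hrΓ y hy] at h1
  have h2 := dist_triangle (r w) y w
  rw [dist_comm y w] at h2
  linarith

theorem dbar_eq_zero_of_const {R : ℝ} (hrR : ∀ w, R ≤ ‖w‖ → r w = p) {w : ℂ} (hw : R < ‖w‖) :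
    dbar r w = 0 := by
  have : r =ᶠ[𝓝 w] fun _ => p := by
    filter_upwards [(isOpen_lt continuous_const continuous_norm).mem_nhds hw] with v hv
    exact hrR v (le_of_lt hv)
  rw [dbar_congr this, dbar_const]

/-- The `N` factors `r - w` absorb the growth of `g` at `Γ`, and `∂̄r` vanishes beyond radius `R`,
so the density is bounded with bounded support. -/
theorem integrable_reprDensity (hne : Γ.Nonempty) (hgm : Measurable g) (hr : LipschitzWith M r)
    (hrΓ : ∀ w ∈ Γ, r w = w) (hrR : ∀ w, R ≤ ‖w‖ → r w = p)
    (hgrow : ∀ w, ‖w‖ ≤ R → ‖g w‖ * Metric.infDist w Γ ^ N ≤ A) :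
    Integrable (reprDensity g r N) := by
  refine integrable_of_norm_le
    (M := ‖-(((N + 1 : ℕ) : ℂ) / Real.pi)‖ * (|A| * (M + 1) ^ N * M)) ?_
    (isCompact_closedBall (0 : ℂ) R) (Eventually.of_forall fun w hw => ?_)
    (Eventually.of_forall fun w => ?_)
  · have := hr.continuous.measurable
    exact (((hgm.mul ((this.sub measurable_id).pow_const N)).mul
      (measurable_dbar r)).const_mul _).aestronglyMeasurable
  · rw [mem_closedBall_zero_iff, not_le] at hw
    rw [reprDensity, dbar_eq_zero_of_const hrR hw]; ring
  · rw [reprDensity, norm_mul]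
    gcongr
    rcases lt_or_ge R ‖w‖ with h | h
    · rw [dbar_eq_zero_of_const hrR h, mul_zero, norm_zero]; positivity
    · rw [norm_mul, norm_mul, norm_pow]
      have h1 := norm_retraction_sub_le hne hr hrΓ w
      have h2 := norm_dbar_le hr w
      have h3 := (hgrow w h).trans (le_abs_self A)
      have hd : 0 ≤ Metric.infDist w Γ := Metric.infDist_nonneg
      calc ‖g w‖ * ‖r w - w‖ ^ N * ‖dbar r w‖
          ≤ ‖g w‖ * ((M + 1) * Metric.infDist w Γ) ^ N * M := by gcongr
        _ = (‖g w‖ * Metric.infDist w Γ ^ N) * (M + 1) ^ N * M := by rw [mul_pow]; ring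
        _ ≤ |A| * (M + 1) ^ N * M := by gcongr

end Representation

section Representation

variable {Γ : Set ℂ} {g r : ℂ → ℂ} {R A : ℝ} {p : ℂ} {M : ℝ≥0} {N : ℕ}

/-- The Cauchy–Pompeiu formula for `g κ q ^ (N + 1)`, where `κ` is a cutoff function and
`q = (r - w) / (r - z)`. -/
theorem cauchy_cutoff_retraction (hΓ : IsClosed Γ) (hne : Γ.Nonempty) (hnull : volume Γ = 0)
    (hg : DifferentiableOn ℂ g Γᶜ) (hr : LipschitzWith M r) (hrΓ : ∀ w ∈ Γ, r w = w)
    (hr' : ∀ w, r w ∈ Γ) {S : ℝ} (hS : 0 < S) {A : ℝ}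
    (hgrow : ∀ w, ‖w‖ ≤ 2 * S → ‖g w‖ * Metric.infDist w Γ ^ N ≤ A) {z : ℂ} (hz : z ∉ Γ)
    (hzS : ‖z‖ ≤ S) :
    ∫ w, (g w * dbar (cutoff S) w * (((r w - w) / (r w - z)) ^ (N + 1) * (w - z)⁻¹) +
      ((N + 1 : ℕ) : ℂ) * (g w * cutoff S w * (r w - w) ^ N * dbar r w) / (r w - z) ^ (N + 2)) =
    -(Real.pi * g z) := by
  have hzr : ∀ w, r w - z ≠ 0 := fun w h => hz (by rw [← sub_eq_zero.1 h]; exact hr' w)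
  set δ := Metric.infDist z Γ with hδ
  have hδ0 : 0 < δ := (hΓ.notMem_iff_infDist_pos hne).1 hz
  have hδr : ∀ w, δ ≤ ‖r w - z‖ := fun w => by
    rw [← dist_eq_norm, dist_comm]
    exact Metric.infDist_le_dist_of_mem (hr' w)
  have hA0 : 0 ≤ A :=
    (mul_nonneg (norm_nonneg _) (pow_nonneg Metric.infDist_nonneg _)).trans
      (hgrow 0 (by simpa using hS.le))
  set q : ℂ → ℂ := fun w => (r w - w) / (r w - z) with hq
  set u : ℂ → ℂ := fun w => cutoff S w * (g w * q w ^ (N + 1)) with hu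
  have hqn : ∀ w, ‖q w‖ ≤ (M + 1) / δ * Metric.infDist w Γ := by
    intro w
    rw [hq, norm_div, div_mul_eq_mul_div]
    exact div_le_div₀ (mul_nonneg (by positivity) Metric.infDist_nonneg)
      (norm_retraction_sub_le hne hr hrΓ w) hδ0 (hδr w)
  have hgq : ∀ w, ‖w‖ ≤ 2 * S → ‖g w‖ * ‖q w‖ ^ N ≤ A * ((M + 1) / δ) ^ N := by
    intro w hw
    calc ‖g w‖ * ‖q w‖ ^ N ≤ ‖g w‖ * ((M + 1) / δ * Metric.infDist w Γ) ^ N := by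
          gcongr; exact hqn w
      _ = (‖g w‖ * Metric.infDist w Γ ^ N) * ((M + 1) / δ) ^ N := by rw [mul_pow]; ring
      _ ≤ _ := by gcongr; exact hgrow w hw
  -- `N` factors of `q` only make the product bounded; the extra one makes it vanish at `Γ`, as
  -- removability requires.
  have hgq' : ∀ w, ‖w‖ ≤ 2 * S →
      ‖g w‖ * ‖q w‖ ^ (N + 1) ≤ A * ((M + 1) / δ) ^ (N + 1) * Metric.infDist w Γ := by
    intro w hw
    calc ‖g w‖ * ‖q w‖ ^ (N + 1) = (‖g w‖ * ‖q w‖ ^ N) * ‖q w‖ := by ring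
      _ ≤ (A * ((M + 1) / δ) ^ N) * ((M + 1) / δ * Metric.infDist w Γ) :=
        mul_le_mul (hgq w hw) (hqn w) (norm_nonneg _) (by positivity)
      _ = _ := by ring
  have hqlip : ∀ x, LipAt q x := fun x =>
    ((LipAt.of_lipschitzWith hr x).sub (lipAt_id x)).div
      ((LipAt.of_lipschitzWith hr x).sub (lipAt_const z x)) (hzr x)
  have hulip : ∀ x ∉ Γ, LipAt u x := fun x hx =>
    (LipAt.of_lipschitzWith (lipschitzWith_cutoff S) x).mul
      ((lipAt_of_differentiableOn hΓ.isOpen_compl hg hx).mul ((hqlip x).pow _))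
  have huc : HasCompactSupport u := (hasCompactSupport_cutoff hS).mul_right
  have hun : ∀ w, ‖u w‖ ≤ A * ((M + 1) / δ) ^ (N + 1) * Metric.infDist w Γ := by
    intro w
    rcases le_or_gt (2 * S) ‖w‖ with h | h
    · have : 0 ≤ Metric.infDist w Γ := Metric.infDist_nonneg
      simp only [hu, cutoff_of_ge hS h, zero_mul, norm_zero]
      positivity
    · rw [hu, norm_mul, norm_mul, norm_pow]
      exact (mul_le_of_le_one_left (by positivity) (norm_cutoff_le S w)).trans (hgq' w h.le)
  have hdiff : ∀ᵐ w : ℂ, w ∉ Γ ∧ DifferentiableAt ℝ u w ∧ dbar u w =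
      dbar (cutoff S) w * (g w * q w ^ (N + 1)) + cutoff S w * (g w *
        (((N + 1 : ℕ) : ℂ) * q w ^ N * ((w - z) / (r w - z) ^ 2 * dbar r w))) := by
    filter_upwards [measure_eq_zero_iff_ae_notMem.1 hnull,
      (lipschitzWith_cutoff S).ae_differentiableAt (μ := volume),
      hr.ae_differentiableAt (μ := volume)] with w hw h1 h2
    have h3 := hg.differentiableAt (hΓ.isOpen_compl.mem_nhds hw)
    have h4 : HasDerivAt (fun v : ℂ => v ^ (N + 1)) (((N + 1 : ℕ) : ℂ) * q w ^ N) (q w) := by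
      simpa using hasDerivAt_pow (N + 1) (q w)
    have h5 : HasDerivAt (fun v : ℂ => (v - z)⁻¹) (-1 / (r w - z) ^ 2) (r w) :=
      ((hasDerivAt_id (r w)).sub_const z).inv (hzr w)
    have hinv : DifferentiableAt ℝ (fun w => (r w - z)⁻¹) w :=
      (h5.differentiableAt.restrictScalars ℝ).comp w h2
    have hzw : DifferentiableAt ℂ (fun w : ℂ => z - w) w := by fun_prop
    -- In this form `r` occurs only in the denominator, and `∂̄q` visibly carries the factor `w - z`
    -- that will cancel the Cauchy kernel.
    have hqe : q = fun w => 1 + (z - w) * (r w - z)⁻¹ := by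
      funext w
      rw [hq]
      field_simp [hzr w]
      ring
    have hqd : DifferentiableAt ℝ q w := by
      rw [hqe]
      exact ((hzw.restrictScalars ℝ).mul hinv).const_add 1
    have hqb : dbar q w = (w - z) / (r w - z) ^ 2 * dbar r w := by
      have e : dbar q w = dbar (fun w => (z - w) * (r w - z)⁻¹) w := by
        rw [hqe]
        simp only [dbar, fderiv_const_add]
      rw [e, dbar_mul (hzw.restrictScalars ℝ) hinv, dbar_eq_zero hzw, dbar_comp h5 h2]
      ring
    have hpow : DifferentiableAt ℝ (fun w => q w ^ (N + 1)) w := hqd.pow _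
    have hgp : DifferentiableAt ℝ (fun w => g w * q w ^ (N + 1)) w :=
      (h3.restrictScalars ℝ).mul hpow
    refine ⟨hw, h1.mul hgp, ?_⟩
    rw [hu, dbar_mul h1 hgp, dbar_mul (h3.restrictScalars ℝ) hpow, dbar_eq_zero h3,
      dbar_comp h4 hqd, hqb]
    ring
  obtain ⟨y, hy⟩ := hne
  have hB : ∀ᵐ w : ℂ, ‖dbar u w‖ ≤ S⁻¹ * (A * ((M + 1) / δ) ^ (N + 1) * (2 * S + ‖y‖)) +
      A * ((M + 1) / δ) ^ N * ((N + 1 : ℕ) * ((2 * S + ‖z‖) / δ ^ 2 * M)) := by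
    filter_upwards [hdiff] with w hw
    rw [hw.2.2]
    rcases lt_or_ge (2 * S) ‖w‖ with h | h
    · rw [dbar_cutoff_of_gt hS h, cutoff_of_ge hS h.le, zero_mul, zero_mul, add_zero, norm_zero]
      positivity
    refine (norm_add_le _ _).trans (add_le_add ?_ ?_)
    · rw [norm_mul, norm_mul, norm_pow]
      have h1 : Metric.infDist w Γ ≤ 2 * S + ‖y‖ := by
        refine (Metric.infDist_le_dist_of_mem hy).trans ?_
        rw [dist_eq_norm]
        exact (norm_sub_le _ _).trans (by gcongr)
      have h2 := norm_dbar_cutoff_le hS w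
      have h3 := hgq' w h
      exact mul_le_mul h2 (h3.trans (by gcongr)) (by positivity) (by positivity)
    · rw [norm_mul]
      refine (mul_le_of_le_one_left (norm_nonneg _) (norm_cutoff_le S w)).trans ?_
      rw [norm_mul, norm_mul, norm_mul, norm_mul, norm_pow (q w), norm_div (w - z),
        norm_pow (r w - z), Complex.norm_natCast]
      have h1 : ‖w - z‖ ≤ 2 * S + ‖z‖ := (norm_sub_le _ _).trans (by gcongr)
      have h2 := norm_dbar_le hr w
      have h3 := hgq w h
      have h4 := hδr w
      calc ‖g w‖ * (((N + 1 : ℕ) : ℝ) * ‖q w‖ ^ N * (‖w - z‖ / ‖r w - z‖ ^ 2 * ‖dbar r w‖))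
          = (‖g w‖ * ‖q w‖ ^ N) *
            (((N + 1 : ℕ) : ℝ) * (‖w - z‖ / ‖r w - z‖ ^ 2 * ‖dbar r w‖)) := by ring
        _ ≤ _ := by gcongr
  have key := integral_dbar_div_of_removable hΓ ⟨y, hy⟩ hnull hulip huc
    (hdiff.mono fun w h => h.2.1) (by positivity) hun hB hz
  have huz : u z = g z := by
    rw [hu, hq]
    simp only
    rw [cutoff_of_le hS hzS, div_self (hzr z), one_pow, mul_one, one_mul]
  rw [huz] at key
  rw [← key]
  refine integral_congr_ae ?_
  filter_upwards [hdiff, Measure.ae_ne (μ := (volume : Measure ℂ)) z] with w hw hwz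
  have h0 : w - z ≠ 0 := sub_ne_zero.2 hwz
  have h1 := hzr w
  rw [hw.2.2]
  simp only [hq, div_pow]
  field_simp
  ring

/-- A geometric sum with ratio `x = (p - w) / (p - z)`, where `1 - x = (w - z) / (p - z)`. It turns
the kernel on the annulus, where `r = p`, into poles at `p`. -/
theorem geom_retraction {p w z : ℂ} (hp : p - z ≠ 0) (hw : w - z ≠ 0) (m : ℕ) :
    ((p - w) / (p - z)) ^ m * (w - z)⁻¹ =
      (w - z)⁻¹ - ∑ j ∈ Finset.range m, (p - w) ^ j * ((p - z) ^ (j + 1))⁻¹ := by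
  have h1 : (∑ j ∈ Finset.range m, (p - w) ^ j * ((p - z) ^ (j + 1))⁻¹) =
      (∑ j ∈ Finset.range m, ((p - w) / (p - z)) ^ j) * (p - z)⁻¹ := by
    rw [Finset.sum_mul]
    refine Finset.sum_congr rfl fun j _ => ?_
    rw [div_pow, pow_succ]
    field_simp
  have h2 := geom_sum_mul_neg ((p - w) / (p - z)) m
  have h3 : 1 - (p - w) / (p - z) = (w - z) * (p - z)⁻¹ := by field_simp; ring
  rw [h3, ← mul_assoc] at h2
  rw [h1, eq_sub_iff_add_eq, ← eq_sub_iff_add_eq', ← one_sub_mul]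
  rw [← h2]
  field_simp

/-- A function of slow growth is a sum of poles at `p` and a Cauchy-type integral over `Γ`. -/
theorem exists_cauchy_representation (hΓ : IsClosed Γ) (hne : Γ.Nonempty) (hnull : volume Γ = 0)
    (hg : DifferentiableOn ℂ g Γᶜ) (hgm : Measurable g) (hR : 0 < R) (hΓR : Γ ⊆ Metric.ball 0 R)
    (hA : ∀ w, R ≤ ‖w‖ → ‖g w‖ ≤ A / ‖w‖)
    (hgrow : ∀ S, ∃ B, ∀ w, ‖w‖ ≤ S → ‖g w‖ * Metric.infDist w Γ ^ N ≤ B)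
    (hr : LipschitzWith M r) (hrΓ : ∀ w ∈ Γ, r w = w) (hr' : ∀ w, r w ∈ Γ)
    (hrR : ∀ w, R ≤ ‖w‖ → r w = p) :
    ∃ c : ℕ → ℂ, ∀ z ∉ Γ, g z = ∑ j ∈ Finset.range (N + 1), c j / (p - z) ^ (j + 1) +
      ∫ w, reprDensity g r N w / (r w - z) ^ (N + 2) := by
  have hpi : (Real.pi : ℂ) ≠ 0 := by exact_mod_cast Real.pi_ne_zero
  have hp : p ∈ Γ := by
    have := hrR R (by simp [abs_of_pos hR])
    rw [← this]; exact hr' _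
  have hA0 : 0 ≤ A := by
    have h := (norm_nonneg _).trans (hA R (by simp [abs_of_pos hR]))
    rw [Complex.norm_real, Real.norm_eq_abs, abs_of_pos hR] at h
    exact (div_nonneg_iff.1 h).elim And.left fun h => absurd hR (not_lt.2 h.2)
  have hA' : ∀ w, R ≤ ‖w‖ → ‖g w‖ ≤ A / R := fun w hw => (hA w hw).trans (by gcongr)
  have hrm : Measurable r := hr.continuous.measurable
  refine ⟨fun j => (Real.pi : ℂ)⁻¹ * ∫ w, g w * dbar (cutoff R) w * (p - w) ^ j, fun z hz => ?_⟩
  have hzr : ∀ w, r w - z ≠ 0 := fun w h => hz (by rw [← sub_eq_zero.1 h]; exact hr' w)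
  have hpz : p - z ≠ 0 := fun h => hz (by rw [← sub_eq_zero.1 h]; exact hp)
  have hintD : Integrable (fun w => reprDensity g r N w / (r w - z) ^ (N + 2)) := by
    obtain ⟨B, hB⟩ := hgrow R
    have hδ0 : 0 < Metric.infDist z Γ := (hΓ.notMem_iff_infDist_pos hne).1 hz
    have hi := integrable_reprDensity hne hgm hr hrΓ hrR hB
    simp only [div_eq_mul_inv]
    refine hi.mul_bdd (c := (Metric.infDist z Γ ^ (N + 2))⁻¹) (by fun_prop)
      (Eventually.of_forall fun w => ?_)
    rw [norm_inv, norm_pow]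
    gcongr
    rw [← dist_eq_norm, dist_comm]
    exact Metric.infDist_le_dist_of_mem (hr' w)
  -- The moments on the right are taken at the fixed radius `R`, so only the left side depends on
  -- `S`, and it tends to zero.
  have main : ∀ᶠ S : ℝ in atTop, ∫ w, g w * dbar (cutoff S) w * (w - z)⁻¹ =
      -(Real.pi * g z) + (∑ j ∈ Finset.range (N + 1),
        (∫ w, g w * dbar (cutoff R) w * (p - w) ^ j) * ((p - z) ^ (j + 1))⁻¹) +
      Real.pi * ∫ w, reprDensity g r N w / (r w - z) ^ (N + 2) := by
    filter_upwards [eventually_gt_atTop R, eventually_gt_atTop ‖z‖] with S hSR hSz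
    have hS : 0 < S := hR.trans hSR
    obtain ⟨B, hB⟩ := hgrow (2 * S)
    have h1 := cauchy_cutoff_retraction hΓ hne hnull hg hr hrΓ hr' hS hB hz hSz.le
    have hi1 : Integrable (fun w => g w * dbar (cutoff S) w * (w - z)⁻¹) := by
      refine integrable_mul_dbar_cutoff (A := A / R) (B := (S - ‖z‖)⁻¹) hgm (by fun_prop) hS
        (fun w hw => hA' w (hSR.le.trans hw)) fun w hw _ => ?_
      rw [norm_inv]
      have : S - ‖z‖ ≤ ‖w - z‖ := (sub_le_sub_right hw _).trans (norm_sub_norm_le w z)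
      have : 0 < S - ‖z‖ := sub_pos.2 hSz
      gcongr
    have hi2 : ∀ j : ℕ, Integrable (fun w => g w * dbar (cutoff S) w * (p - w) ^ j) := by
      intro j
      refine integrable_mul_dbar_cutoff (A := A / R) (B := (‖p‖ + 2 * S) ^ j) hgm (by fun_prop) hS
        (fun w hw => hA' w (hSR.le.trans hw)) fun w _ hw => ?_
      rw [norm_pow]
      gcongr
      exact (norm_sub_le _ _).trans (by gcongr)
    have e : ∀ w, g w * dbar (cutoff S) w * (((r w - w) / (r w - z)) ^ (N + 1) * (w - z)⁻¹) +
        ((N + 1 : ℕ) : ℂ) * (g w * cutoff S w * (r w - w) ^ N * dbar r w) / (r w - z) ^ (N + 2) =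
        (g w * dbar (cutoff S) w * (w - z)⁻¹ - ∑ j ∈ Finset.range (N + 1),
          g w * dbar (cutoff S) w * (p - w) ^ j * ((p - z) ^ (j + 1))⁻¹) -
        Real.pi * (reprDensity g r N w / (r w - z) ^ (N + 2)) := by
      intro w
      have e1 : g w * dbar (cutoff S) w * (((r w - w) / (r w - z)) ^ (N + 1) * (w - z)⁻¹) =
          g w * dbar (cutoff S) w * (w - z)⁻¹ - ∑ j ∈ Finset.range (N + 1),
          g w * dbar (cutoff S) w * (p - w) ^ j * ((p - z) ^ (j + 1))⁻¹ := by
        rcases lt_or_ge ‖w‖ S with h | h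
        · simp [dbar_cutoff_of_lt hS h]
        · have hwz : w - z ≠ 0 := by
            intro h0
            rw [sub_eq_zero.1 h0] at h
            exact absurd h (not_le.2 hSz)
          rw [hrR w (hSR.le.trans h), geom_retraction hpz hwz, mul_sub, Finset.mul_sum]
          congr 1
          exact Finset.sum_congr rfl fun j _ => by ring
      -- The cutoff is one wherever `∂̄r` is nonzero, because `R < S`.
      have e2 : cutoff S w * dbar r w = dbar r w := by
        rcases le_or_gt ‖w‖ S with h | h
        · rw [cutoff_of_le hS h, one_mul]
        · rw [dbar_eq_zero_of_const hrR (hSR.trans h), mul_zero]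
      have e3 : g w * cutoff S w * (r w - w) ^ N * dbar r w =
          g w * (r w - w) ^ N * dbar r w := by
        linear_combination (g w * (r w - w) ^ N) * e2
      rw [e1, e3, reprDensity]
      have := hzr w
      field_simp
      ring
    rw [integral_congr_ae (Eventually.of_forall e), integral_sub, integral_sub hi1,
      integral_finsetSum, integral_const_mul] at h1
    · simp only [integral_mul_const] at h1
      simp only [fun j => integral_dbar_cutoff_pow_eq (p := p) hΓ hnull hg hgm hΓR hA' hR hS le_rfl
        hSR.le j]
      linear_combination h1
    · exact fun j _ => (hi2 j).mul_const _
    · exact integrable_finsetSum _ fun j _ => (hi2 j).mul_const _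
    · exact hi1.sub (integrable_finsetSum _ fun j _ => (hi2 j).mul_const _)
    · exact hintD.const_mul _
  have hlim := tendsto_nhds_unique (tendsto_const_nhds.congr' (main.mono fun S h => h.symm))
    (tendsto_integral_dbar_cutoff_div hR hA z)
  have e : ∑ j ∈ Finset.range (N + 1), (Real.pi : ℂ)⁻¹ *
      (∫ w, g w * dbar (cutoff R) w * (p - w) ^ j) / (p - z) ^ (j + 1) =
      (Real.pi : ℂ)⁻¹ * ∑ j ∈ Finset.range (N + 1),
        (∫ w, g w * dbar (cutoff R) w * (p - w) ^ j) * ((p - z) ^ (j + 1))⁻¹ := by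
    rw [Finset.mul_sum]
    exact Finset.sum_congr rfl fun j _ => by rw [div_eq_mul_inv, mul_assoc]
  rw [e]
  apply mul_left_cancel₀ hpi
  rw [mul_add, mul_inv_cancel_left₀ hpi]
  linear_combination -hlim

end Representation

/-! ### Integration against complex measures -/

section ComplexMeasure

variable {X : Type*} [MeasurableSpace X]

theorem isFiniteMeasure_variation_withDensityᵥ {μ : Measure X} {h : X → ℂ} (hh : Integrable h μ) :
    IsFiniteMeasure (μ.withDensityᵥ h).variation := by
  rw [Measure.variation_withDensityᵥ hh]
  exact isFiniteMeasure_withDensity hh.2.ne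

theorem cintegral_withDensityᵥ_simpleFunc {μ : Measure X} {h : X → ℂ} (hh : Integrable h μ)
    (s : SimpleFunc X ℂ) : cintegral (μ.withDensityᵥ h) s = ∫ x, s x * h x ∂μ := by
  have := isFiniteMeasure_variation_withDensityᵥ hh
  induction s using SimpleFunc.induction with
  | @const c s hs =>
    have e : ⇑(SimpleFunc.piecewise s hs (SimpleFunc.const X c) (SimpleFunc.const X 0)) =
        s.indicator (fun _ => c) := by
      ext x; simp [Set.indicator]
    rw [e, cintegral, VectorMeasure.integral_indicator hs, VectorMeasure.integral_const,
      VectorMeasure.restrict_apply _ hs MeasurableSet.univ, univ_inter,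
      withDensityᵥ_apply hh hs]
    simp only [ContinuousLinearMap.mul_apply', ← indicator_mul_left]
    rw [integral_indicator hs, integral_const_mul]
  | @add f g _ hf hg =>
    have hi : ∀ f : SimpleFunc X ℂ, Integrable f (μ.withDensityᵥ h).variation := fun f =>
      SimpleFunc.integrable_of_isFiniteMeasure f
    have hi' : ∀ f : SimpleFunc X ℂ, Integrable (fun x => f x * h x) μ := by
      intro f
      obtain ⟨C, hC⟩ := f.exists_forall_norm_le
      exact hh.bdd_mul f.stronglyMeasurable.aestronglyMeasurable (Eventually.of_forall hC)
    rw [cintegral] at hf hg ⊢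
    rw [SimpleFunc.coe_add, VectorMeasure.integral_add (hi f) (hi g), hf, hg,
      ← integral_add (hi' f) (hi' g)]
    simp only [Pi.add_apply, add_mul]

/-- Bounded simple approximations converge on both sides by dominated convergence. This reduces
vector-measure integrals to Bochner integrals. -/
theorem cintegral_withDensityᵥ {μ : Measure X} {h : X → ℂ} (hh : Integrable h μ) {g : X → ℂ}
    (hg : StronglyMeasurable g) {C : ℝ} (hC : ∀ x, ‖g x‖ ≤ C) :
    cintegral (μ.withDensityᵥ h) g = ∫ x, g x * h x ∂μ := by
  have := isFiniteMeasure_variation_withDensityᵥ hh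
  rcases isEmpty_or_nonempty X with hX | ⟨⟨x⟩⟩
  · rw [cintegral, VectorMeasure.integral_of_isEmpty, integral_of_isEmpty]
  have hC0 : 0 ≤ C := (norm_nonneg _).trans (hC x)
  have hlim : ∀ x, Tendsto (fun n => hg.approxBounded C n x) atTop (𝓝 (g x)) := fun x =>
    hg.tendsto_approxBounded_of_norm_le (hC x)
  have h1 : Tendsto (fun n => cintegral (μ.withDensityᵥ h) (hg.approxBounded C n)) atTop
      (𝓝 (cintegral (μ.withDensityᵥ h) g)) :=
    VectorMeasure.tendsto_integral_filter_of_norm_le_const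
      (Eventually.of_forall fun n => (hg.approxBounded C n).stronglyMeasurable.aestronglyMeasurable)
      ⟨C, Eventually.of_forall fun n => Eventually.of_forall fun x =>
        hg.norm_approxBounded_le hC0 n x⟩ (Eventually.of_forall hlim)
  have h2 : Tendsto (fun n => ∫ x, hg.approxBounded C n x * h x ∂μ) atTop
      (𝓝 (∫ x, g x * h x ∂μ)) := by
    refine tendsto_integral_of_dominated_convergence (fun x => C * ‖h x‖) (fun n =>
      (hg.approxBounded C n).stronglyMeasurable.aestronglyMeasurable.mul hh.aestronglyMeasurable)
      (hh.norm.const_mul C) (fun n => Eventually.of_forall fun x => ?_)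
      (Eventually.of_forall fun x => (hlim x).mul_const _)
    rw [norm_mul]
    gcongr
    exact hg.norm_approxBounded_le hC0 n x
  refine tendsto_nhds_unique h1 (h2.congr fun n => ?_)
  exact (cintegral_withDensityᵥ_simpleFunc hh _).symm

theorem cintegral_map_withDensityᵥ {Y : Type*} [MeasurableSpace Y] {μ : Measure X} {h : X → ℂ}
    (hh : Integrable h μ) {τ : X → Y} (hτ : Measurable τ) {g : Y → ℂ} (hg : StronglyMeasurable g)
    {C : ℝ} (hC : ∀ x, ‖g x‖ ≤ C) :
    cintegral ((μ.withDensityᵥ h).map τ) g = ∫ x, g (τ x) * h x ∂μ := by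
  have := isFiniteMeasure_variation_withDensityᵥ hh
  have e := cintegral_withDensityᵥ hh (hg.comp_measurable hτ) (C := C) fun x => hC (τ x)
  refine Eq.trans ?_ e
  exact VectorMeasure.integral_map hτ hg.aestronglyMeasurable
    (Integrable.of_bound (hg.comp_measurable hτ).aestronglyMeasurable C
      (Eventually.of_forall fun x => hC (τ x)))

/-- Radon–Nikodym, applied to the real and imaginary parts with respect to the sum of their total
variations. -/
theorem exists_eq_withDensityᵥ (μ : ComplexMeasure X) :
    ∃ (ν : Measure X) (h : X → ℂ), IsFiniteMeasure ν ∧ Integrable h ν ∧ μ = ν.withDensityᵥ h := by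
  let ν : Measure X :=
    (ComplexMeasure.re μ).totalVariation + (ComplexMeasure.im μ).totalVariation
  have h1 : (ComplexMeasure.re μ).totalVariation ≪ ν := Measure.absolutelyContinuous_of_le
    (Measure.le_add_right le_rfl)
  have h2 : (ComplexMeasure.im μ).totalVariation ≪ ν := Measure.absolutelyContinuous_of_le
    (Measure.le_add_left le_rfl)
  have key : ∀ s : SignedMeasure X, s.totalVariation ≪ ν → ν.withDensityᵥ (s.rnDeriv ν) = s := by
    intro s hs
    refine SignedMeasure.withDensityᵥ_rnDeriv_eq s ν ?_
    rw [SignedMeasure.absolutelyContinuous_ennreal_iff, 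
      VectorMeasure.ennrealToMeasure_toENNRealVectorMeasure]
    exact hs
  have hi := ComplexMeasure.integrable_rnDeriv μ ν
  refine ⟨ν, μ.rnDeriv ν, inferInstance, hi, ?_⟩
  ext i hm : 1
  apply Complex.ext
  · rw [withDensityᵥ_apply hi hm, ← RCLike.re_eq_complex_re, ← integral_re hi.integrableOn,
      RCLike.re_eq_complex_re]
    change (ComplexMeasure.re μ) i = ∫ x in i, (ComplexMeasure.re μ).rnDeriv ν x ∂ν
    rw [← withDensityᵥ_apply (SignedMeasure.integrable_rnDeriv _ _) hm, key _ h1]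
  · rw [withDensityᵥ_apply hi hm, ← RCLike.im_eq_complex_im, ← integral_im hi.integrableOn,
      RCLike.im_eq_complex_im]
    change (ComplexMeasure.im μ) i = ∫ x in i, (ComplexMeasure.im μ).rnDeriv ν x ∂ν
    rw [← withDensityᵥ_apply (SignedMeasure.integrable_rnDeriv _ _) hm, key _ h2]

end ComplexMeasure

/-! ### Slowly growing functions in the affine chart and existence of normal forms -/

/-- Since `sin x ≤ x` for `x ≥ 0`, the arcsine dominates its argument, so on bounded sets the
spherical distance dominates a multiple of the Euclidean one. Growth bounds thus pass to the affine
chart. -/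
theorem le_sphereDist {z w : ℂ} {S T : ℝ} (hz : ‖z‖ ≤ S) (hw : ‖w‖ ≤ T) :
    2 * (‖z - w‖ / (√(1 + S ^ 2) * √(1 + T ^ 2))) ≤ sphereDist (z : OnePoint ℂ) (w : OnePoint ℂ) := by
  have e : halfChord (z : OnePoint ℂ) (w : OnePoint ℂ) =
      ‖z - w‖ / (√(1 + ‖z‖ ^ 2) * √(1 + ‖w‖ ^ 2)) := rfl
  have hz0 := norm_nonneg z
  have hw0 := norm_nonneg w
  have hp : 0 < √(1 + ‖z‖ ^ 2) * √(1 + ‖w‖ ^ 2) := by positivity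
  have h0 : 0 ≤ halfChord (z : OnePoint ℂ) (w : OnePoint ℂ) := by rw [e]; positivity
  have h1 : halfChord (z : OnePoint ℂ) (w : OnePoint ℂ) ≤ 1 := by
    rw [e, div_le_one hp, ← Real.sqrt_mul (by positivity)]
    refine Real.le_sqrt_of_sq_le ?_
    have h := norm_sub_le z w
    have h' := norm_nonneg (z - w)
    nlinarith [sq_nonneg (1 - ‖z‖ * ‖w‖)]
  have h2 : halfChord (z : OnePoint ℂ) (w : OnePoint ℂ) ≤
      Real.arcsin (halfChord (z : OnePoint ℂ) (w : OnePoint ℂ)) := by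
    have := Real.sin_le (Real.arcsin_nonneg.2 h0)
    rwa [Real.sin_arcsin (by linarith) h1] at this
  rw [sphereDist]
  refine mul_le_mul_of_nonneg_left (le_trans ?_ h2) zero_le_two
  rw [e]
  gcongr

section SlowlyGrowing

variable {a b : ℝ} {γ : Icc a b → ℂ} {f : OnePoint ℂ → ℂ}

theorem coe_mem_sphereTrace {z : ℂ} : (z : OnePoint ℂ) ∈ sphereTrace γ ↔ z ∈ range γ := by
  simp [sphereTrace]

theorem infty_notMem_sphereTrace : (OnePoint.infty : OnePoint ℂ) ∉ sphereTrace γ := by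
  rintro ⟨t, ht⟩
  exact OnePoint.coe_ne_infty _ ht

/-- The function `f - f ∞` in the affine chart, set to `0` on the curve. -/
def affinePart (γ : Icc a b → ℂ) (f : OnePoint ℂ → ℂ) : ℂ → ℂ :=
  (range γ)ᶜ.indicator fun w => f (w : OnePoint ℂ) - f OnePoint.infty

theorem affinePart_of_notMem {z : ℂ} (hz : z ∉ range γ) :
    affinePart γ f z = f (z : OnePoint ℂ) - f OnePoint.infty :=
  indicator_of_mem (by exact hz) _

theorem affinePart_of_mem {z : ℂ} (hz : z ∈ range γ) : affinePart γ f z = 0 :=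
  indicator_of_notMem (notMem_compl_iff.2 hz) _

theorem differentiableOn_affinePart (hf : f ∈ slowlyGrowing (sphereTrace γ)) :
    DifferentiableOn ℂ (affinePart γ f) (range γ)ᶜ := by
  have h := hf.1.1
  have e : {z : ℂ | (z : OnePoint ℂ) ∈ (sphereTrace γ)ᶜ} = (range γ)ᶜ := by
    ext z
    simp only [mem_ofPred_eq, mem_compl_iff, coe_mem_sphereTrace]
  rw [e] at h
  exact (h.sub_const _).congr fun z hz => affinePart_of_notMem hz

theorem measurable_affinePart (hγ : Continuous γ) (hf : f ∈ slowlyGrowing (sphereTrace γ)) :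
    Measurable (affinePart γ f) := by
  have hc : IsClosed (range γ) := (isCompact_range hγ).isClosed
  classical
  have h := ContinuousOn.measurable_piecewise (s := (range γ)ᶜ) (f := affinePart γ f) (g := 0)
    (differentiableOn_affinePart hf).continuousOn continuousOn_const hc.measurableSet.compl
  convert h using 1
  funext z
  by_cases hz : z ∈ range γ
  · rw [affinePart_of_mem hz, piecewise_eq_of_notMem _ _ _ (notMem_compl_iff.2 hz)]; rfl
  · rw [piecewise_eq_of_mem _ _ _ (by exact hz)]

theorem exists_growth_affinePart [Nonempty (Icc a b)] (hγ : Continuous γ)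
    (hf : f ∈ slowlyGrowing (sphereTrace γ)) :
    ∃ N : ℕ, ∀ S : ℝ, ∃ B, ∀ w, ‖w‖ ≤ S →
      ‖affinePart γ f w‖ * Metric.infDist w (range γ) ^ N ≤ B := by
  obtain ⟨-, N, K, hK, hgrow⟩ := hf
  obtain ⟨T, hT⟩ := (isCompact_range hγ).isBounded.exists_norm_le
  obtain ⟨t₀⟩ := ‹Nonempty (Icc a b)›
  have hT0 : 0 ≤ T := (norm_nonneg _).trans (hT _ (mem_range_self t₀))
  have hcl : IsClosed (range γ) := (isCompact_range hγ).isClosed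
  have hne : (range γ).Nonempty := ⟨_, mem_range_self t₀⟩
  -- The second summand pays for subtracting `f(∞)`: on the disc of radius `S` the distance to `Γ`
  -- is at most `S + T`.
  refine ⟨N, fun S => ⟨K / (2 / (√(1 + S ^ 2) * √(1 + T ^ 2))) ^ N +
    ‖f OnePoint.infty‖ * (S + T) ^ N, fun w hw => ?_⟩⟩
  have hS0 : 0 ≤ S := (norm_nonneg _).trans hw
  set c : ℝ := 2 / (√(1 + S ^ 2) * √(1 + T ^ 2)) with hc
  have hc0 : 0 < c := by positivity
  by_cases hwΓ : w ∈ range γ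
  · rw [affinePart_of_mem hwΓ, norm_zero, zero_mul]; positivity
  have hd : 0 < Metric.infDist w (range γ) := (hcl.notMem_iff_infDist_pos hne).1 hwΓ
  have h1 : c * Metric.infDist w (range γ) ≤ sphereDistTo (w : OnePoint ℂ) (sphereTrace γ) := by
    have : Nonempty (sphereTrace γ) := ⟨⟨_, mem_range_self t₀⟩⟩
    refine le_ciInf ?_
    rintro ⟨_, t, rfl⟩
    refine le_trans ?_ (le_sphereDist hw (hT _ (mem_range_self t)))
    have h : Metric.infDist w (range γ) ≤ ‖w - γ t‖ := by
      rw [← dist_eq_norm]; exact Metric.infDist_le_dist_of_mem (mem_range_self t)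
    calc c * Metric.infDist w (range γ) ≤ c * ‖w - γ t‖ := by gcongr
      _ = _ := by rw [hc]; ring
  have h2 := hgrow (w : OnePoint ℂ) (by rwa [coe_mem_sphereTrace])
  have h3 : ‖f (w : OnePoint ℂ)‖ ≤ K / (c * Metric.infDist w (range γ)) ^ N :=
    h2.trans (by gcongr)
  have h4 : Metric.infDist w (range γ) ≤ S + T := by
    refine (Metric.infDist_le_dist_of_mem (mem_range_self t₀)).trans ?_
    rw [dist_eq_norm]
    exact (norm_sub_le _ _).trans (add_le_add hw (hT _ (mem_range_self t₀)))
  rw [affinePart_of_notMem hwΓ]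
  calc ‖f (w : OnePoint ℂ) - f OnePoint.infty‖ * Metric.infDist w (range γ) ^ N
      ≤ (K / (c * Metric.infDist w (range γ)) ^ N + ‖f OnePoint.infty‖) *
        Metric.infDist w (range γ) ^ N := by
        gcongr
        exact (norm_sub_le _ _).trans (by gcongr)
    _ = K / c ^ N + ‖f OnePoint.infty‖ * Metric.infDist w (range γ) ^ N := by
        rw [mul_pow]; field_simp
    _ ≤ _ := by gcongr

/-- In the chart at infinity `f` is differentiable at `0`, so `f - f(∞)` is `O(w)` there, which is
`O(1 / ‖w‖)` in the affine chart. -/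
theorem exists_decay_affinePart (hγ : Continuous γ) (hf : f ∈ slowlyGrowing (sphereTrace γ)) :
    ∃ R A : ℝ, 0 < R ∧ 0 ≤ A ∧ ∀ w, R ≤ ‖w‖ → ‖affinePart γ f w‖ ≤ A / ‖w‖ := by
  obtain ⟨T, hT⟩ := (isCompact_range hγ).isBounded.exists_norm_le
  have hinv : ∀ w : ℂ, w ≠ 0 → invChart w⁻¹ = (w : OnePoint ℂ) := fun w hw => by
    rw [invChart, if_neg (inv_ne_zero hw), inv_inv]
  have h0 : invChart 0 = OnePoint.infty := if_pos rfl
  have hmem : {w : ℂ | invChart w ∈ (sphereTrace γ)ᶜ} ∈ 𝓝 (0 : ℂ) := by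
    refine Filter.mem_of_superset (Metric.ball_mem_nhds (0 : ℂ)
      (show (0 : ℝ) < (|T| + 1)⁻¹ by positivity)) fun w hw => ?_
    rw [mem_ball_zero_iff] at hw
    rcases eq_or_ne w 0 with rfl | hw0
    · simp only [mem_ofPred_eq, h0, mem_compl_iff]
      exact infty_notMem_sphereTrace
    · have := hinv w⁻¹ (inv_ne_zero hw0)
      rw [inv_inv] at this
      simp only [mem_ofPred_eq, this, mem_compl_iff, coe_mem_sphereTrace]
      intro h
      have h1 := hT _ h
      rw [norm_inv] at h1
      have h2 : |T| + 1 < ‖w‖⁻¹ := by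
        rwa [lt_inv_comm₀ (by positivity) (norm_pos_iff.2 hw0)]
      linarith [le_abs_self T]
  have hd := (hf.1.2.differentiableAt hmem).isBigO_sub
  obtain ⟨C, hC⟩ := hd.bound
  obtain ⟨δ, hδ, hball⟩ := Metric.eventually_nhds_iff.1 hC
  -- The factor two yields the strict inequality `‖w⁻¹‖ < δ`.
  refine ⟨2 / δ, |C|, by positivity, abs_nonneg C, fun w hw => ?_⟩
  have hwpos : 0 < ‖w‖ := lt_of_lt_of_le (by positivity) hw
  have hw0 : w ≠ 0 := norm_pos_iff.1 hwpos
  by_cases hwΓ : w ∈ range γ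
  · rw [affinePart_of_mem hwΓ, norm_zero]; positivity
  rw [affinePart_of_notMem hwΓ]
  have h1 : dist w⁻¹ 0 < δ := by
    rw [dist_zero_right, norm_inv, inv_lt_comm₀ hwpos hδ]
    refine lt_of_lt_of_le ?_ hw
    rw [div_eq_mul_inv]
    have : 0 < δ⁻¹ := inv_pos.2 hδ
    linarith
  have h2 := hball h1
  rw [hinv w hw0, h0, sub_zero, norm_inv] at h2
  rw [div_eq_mul_inv]
  exact h2.trans (by gcongr; exact le_abs_self C)

theorem exists_normalForm (hab : a ≤ b) (hγ : IsLipschitzCurve γ)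
    (hf : f ∈ slowlyGrowing (sphereTrace γ)) :
    ∃ n : ℕ, ∀ t₀ : Icc a b, ∃ d : NormalFormData a b n, IsSimpleNormalForm γ f n t₀ d := by
  have hne : Nonempty (Icc a b) := ⟨⟨a, le_rfl, hab⟩⟩
  obtain ⟨K, hK⟩ := hγ.lipschitz
  obtain ⟨L, hL⟩ := hγ.antilipschitz
  obtain ⟨R₁, hR₁, hΓR, hret⟩ := exists_lipschitz_retraction hK hL
  obtain ⟨N, hgrow⟩ := exists_growth_affinePart hK.continuous hf
  obtain ⟨R₂, A, hR₂, hA0, hA⟩ := exists_decay_affinePart hK.continuous hf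
  have hcl : IsClosed (range γ) := (isCompact_range hK.continuous).isClosed
  have hneΓ : (range γ).Nonempty := range_nonempty γ
  -- The order depends only on the growth exponent of `f`, hence not on the base point.
  refine ⟨N + 2, fun t₀ => ?_⟩
  obtain ⟨τ, M, hτ, hτγ, hτR⟩ := hret t₀
  have hr : LipschitzWith (K * M) (fun w => γ (τ w)) := hK.comp hτ
  have hrΓ : ∀ w ∈ range γ, γ (τ w) = w := by
    rintro _ ⟨t, rfl⟩
    rw [hτγ]
  have hgm := measurable_affinePart hK.continuous hf
  have hrR : ∀ w, max R₁ R₂ ≤ ‖w‖ → γ (τ w) = γ t₀ := fun w hw => by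
    rw [hτR w ((le_max_left _ _).trans hw)]
  obtain ⟨c, hc⟩ := exists_cauchy_representation (r := fun w => γ (τ w)) (p := γ t₀)
    (R := max R₁ R₂) hcl hneΓ (volume_range_eq_zero hab hK) (differentiableOn_affinePart hf) hgm
    (lt_max_of_lt_left hR₁) (hΓR.trans (Metric.ball_subset_ball (le_max_left _ _)))
    (fun w hw => hA w ((le_max_right _ _).trans hw)) hgrow hr hrΓ (fun w => mem_range_self _) hrR
  obtain ⟨B, hB⟩ := hgrow (max R₁ R₂)
  have hint := integrable_reprDensity hneΓ hgm hr hrΓ hrR hB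
  -- The value `f(∞)` fills degree zero, the poles fill degrees `1, …, N + 1`, and the planar
  -- density is pushed to `[a, b]` by `τ`.
  refine ⟨(Fin.cons (f OnePoint.infty) fun j : Fin (N + 1) => c j,
    (volume.withDensityᵥ (reprDensity (affinePart γ f) (fun w => γ (τ w)) N)).map τ), ?_⟩
  intro z hz
  have hδ0 : 0 < Metric.infDist z (range γ) := (hcl.notMem_iff_infDist_pos hneΓ).1 hz
  have hb : ∀ t, ‖1 / (γ t - z) ^ (N + 1 + 1)‖ ≤ 1 / Metric.infDist z (range γ) ^ (N + 1 + 1) := by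
    intro t
    rw [norm_div, norm_one, norm_pow]
    gcongr
    rw [← dist_eq_norm, dist_comm]
    exact Metric.infDist_le_dist_of_mem (mem_range_self t)
  have hcont : Continuous fun t => 1 / (γ t - z) ^ (N + 1 + 1) := by
    refine continuous_const.div ((hK.continuous.sub continuous_const).pow _) fun t => ?_
    exact pow_ne_zero _ (sub_ne_zero.2 fun h => hz ⟨t, h⟩)
  have h1 := hc z hz
  rw [affinePart_of_notMem hz, sub_eq_iff_eq_add'] at h1
  rw [h1]
  simp only [normalFormFun]
  rw [cintegral_map_withDensityᵥ hint hτ.continuous.measurable hcont.stronglyMeasurable hb,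
    Fin.sum_univ_succ]
  simp only [Fin.cons_zero, Fin.cons_succ, Fin.val_zero, pow_zero, div_one, Fin.val_succ]
  rw [Finset.sum_range, add_assoc]
  congr 2
  refine integral_congr_ae (Eventually.of_forall fun w => ?_)
  simp only
  ring

end SlowlyGrowing

/-! ### Retracts of the plane do not separate it -/

/-- There is no continuous branch of the argument of `w - z₀` near infinity. -/
theorem no_argument_near_infinity {z₀ : ℂ} {R : ℝ} {θ : ℂ → ℝ} (hθ : Continuous θ)
    (h : ∀ w, R < ‖w‖ → w - z₀ = ‖w - z₀‖ * Complex.exp (θ w * Complex.I)) : False := by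
  -- A continuous argument gives a logarithm far out, hence a primitive of `1 / y` around a large
  -- circle, although that integral is `2πi`.
  let ℓ : ℂ → ℂ := fun y => (Real.log ‖y‖ : ℂ) + θ (y + z₀) * Complex.I
  set ρ : ℝ := |R| + ‖z₀‖ + 1 with hρ
  have hρ0 : 0 < ρ := by positivity
  have hfar : ∀ y : ℂ, ρ - 1 < ‖y‖ → R < ‖y + z₀‖ := fun y hy => by
    have h1 := norm_sub_le (y + z₀) z₀
    rw [add_sub_cancel_right] at h1
    linarith [le_abs_self R]
  have hexp : ∀ y : ℂ, ρ - 1 < ‖y‖ → Complex.exp (ℓ y) = y := fun y hy => by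
    have hy0 : 0 < ‖y‖ := lt_of_le_of_lt (by rw [hρ]; have := abs_nonneg R; have := norm_nonneg z₀;
                                             linarith) hy
    have h1 := h (y + z₀) (hfar y hy)
    rw [add_sub_cancel_right] at h1
    rw [Complex.exp_add, ← Complex.ofReal_exp, Real.exp_log hy0, ← h1]
  have hderiv : ∀ y ∈ Metric.sphere (0 : ℂ) ρ, HasDerivAt ℓ (y - 0)⁻¹ y := by
    intro y hy
    have hyn : ‖y‖ = ρ := by simpa using hy
    have hy1 : ρ - 1 < ‖y‖ := by linarith
    have hy0 : ‖y‖ ≠ 0 := by rw [hyn]; exact hρ0.ne'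
    have hc : ContinuousAt ℓ y := by
      have h1 : ContinuousAt (fun y : ℂ => Real.log ‖y‖) y :=
        (continuous_norm.continuousAt).log hy0
      have h2 : ContinuousAt (fun y : ℂ => θ (y + z₀)) y := by fun_prop
      exact (Complex.continuous_ofReal.continuousAt.comp h1).add
        ((Complex.continuous_ofReal.continuousAt.comp h2).mul continuousAt_const)
    have h3 := (Complex.hasDerivAt_exp (ℓ y)).of_local_left_inverse hc (Complex.exp_ne_zero _)
      (by filter_upwards [(isOpen_lt continuous_const continuous_norm).mem_nhds hy1] with v hv
          exact hexp v hv)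
    rw [hexp y hy1] at h3
    rwa [sub_zero]
  have h1 := circleIntegral.integral_eq_zero_of_hasDerivWithinAt hρ0.le
    (fun y hy => (hderiv y hy).hasDerivWithinAt)
  rw [circleIntegral.integral_sub_center_inv _ hρ0.ne'] at h1
  simp [Real.pi_ne_zero] at h1

theorem isPreconnected_exterior (R : ℝ) : IsPreconnected {w : ℂ | |R| < ‖w‖} := by
  have h : {w : ℂ | |R| < ‖w‖} =
      (fun q : ℝ × ℝ => (q.1 : ℂ) * Complex.exp (q.2 * Complex.I)) '' (Ioi |R| ×ˢ univ) := by
    ext w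
    constructor
    · intro hw
      exact ⟨(‖w‖, w.arg), ⟨hw, mem_univ _⟩, Complex.norm_mul_exp_arg_mul_I w⟩
    · rintro ⟨⟨ρ, θ⟩, ⟨hρ, -⟩, rfl⟩
      have hρ' : |R| < ρ := hρ
      have : ‖(ρ : ℂ) * Complex.exp (θ * Complex.I)‖ = ρ := by
        rw [norm_mul, Complex.norm_exp_ofReal_mul_I, mul_one, Complex.norm_real, Real.norm_eq_abs,
          abs_of_pos ((abs_nonneg R).trans_lt hρ')]
      simpa only [mem_ofPred_eq, this] using hρ'
  rw [h]
  exact (isPreconnected_Ioi.prod isPreconnected_univ).image _ (by fun_prop)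

section Retract

variable {Γ : Set ℂ} {r : ℂ → ℂ}

theorem frontier_connectedComponentIn_subset (hΓ : IsClosed Γ) (z₀ : ℂ) :
    frontier (connectedComponentIn Γᶜ z₀) ⊆ Γ := by
  intro x hx
  by_contra hxΓ
  have hopen := hΓ.isOpen_compl.connectedComponentIn (x := z₀)
  have hopenx := hΓ.isOpen_compl.connectedComponentIn (x := x)
  obtain ⟨y, hy, hy'⟩ := mem_closure_iff.1 (frontier_subset_closure hx) _ hopenx
    (mem_connectedComponentIn hxΓ)
  have : connectedComponentIn Γᶜ z₀ = connectedComponentIn Γᶜ x :=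
    (connectedComponentIn_eq hy').trans (connectedComponentIn_eq hy).symm
  rw [hopen.frontier_eq] at hx
  exact hx.2 (this ▸ mem_connectedComponentIn hxΓ)

/-- Borsuk's argument. If the component `V` of `z₀` were bounded, then `r - z₀` on `V` and `w - z₀`
off `V` would agree on the frontier of `V`, which lies in `Γ`, and glue to a nowhere zero map of the
plane. Such a map has a continuous argument, which `w - z₀` does not have near infinity. -/
theorem not_bounded_connectedComponentIn (hΓ : IsClosed Γ) (hr : Continuous r)
    (hrΓ : ∀ w ∈ Γ, r w = w) (hr' : ∀ w, r w ∈ Γ) {z₀ : ℂ} (hz₀ : z₀ ∉ Γ) (R : ℝ) :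
    ∃ w ∈ connectedComponentIn Γᶜ z₀, R < ‖w‖ := by
  by_contra! hbd
  classical
  set V := connectedComponentIn Γᶜ z₀ with hV
  let h : ℂ → ℂ := fun w => if w ∈ V then r w - z₀ else w - z₀
  have hc : Continuous h := by
    refine Continuous.if ?_ (by fun_prop) (by fun_prop)
    intro w hw
    rw [hrΓ w (frontier_connectedComponentIn_subset hΓ z₀ hw)]
  have h0 : ∀ w, h w ≠ 0 := by
    intro w
    by_cases hw : w ∈ V
    · simp only [h, if_pos hw]
      exact sub_ne_zero.2 fun e => hz₀ (e ▸ hr' w)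
    · simp only [h, if_neg hw]
      refine sub_ne_zero.2 fun e => hw ?_
      rw [e]
      exact mem_connectedComponentIn hz₀
  let u : C(ℂ, Circle) :=
    ⟨fun w => ⟨h w / ‖h w‖, mem_sphere_zero_iff_norm.2 (by
      rw [norm_div, Complex.norm_real, norm_norm, div_self (norm_ne_zero_iff.2 (h0 w))])⟩, by
      refine Continuous.subtype_mk (hc.div (by fun_prop) fun w => ?_) _
      exact_mod_cast norm_ne_zero_iff.2 (h0 w)⟩
  -- The plane is simply connected, so `u` lifts through the covering of the circle by the line.
  obtain ⟨θ, ⟨-, hθ⟩, -⟩ := Circle.isCoveringMap_exp.existsUnique_continuousMap_lifts u 0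
    ((u 0 : ℂ).arg) (Circle.exp_arg _)
  refine no_argument_near_infinity (z₀ := z₀) (R := R) θ.continuous fun w hw => ?_
  have hwV : w ∉ V := fun hwV => absurd (hbd w hwV) (not_le.2 hw)
  have h1 : (Circle.exp (θ w) : ℂ) = u w := congrArg _ (congrFun hθ w)
  have h2 : h w = w - z₀ := if_neg hwV
  have h3 : (u w : ℂ) = h w / ‖h w‖ := rfl
  have h4 : (‖h w‖ : ℂ) ≠ 0 := by exact_mod_cast norm_ne_zero_iff.2 (h0 w)
  rw [Circle.coe_exp, h3] at h1
  rw [h1, ← h2, mul_div_cancel₀ _ h4]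

/-- Every component of the complement is unbounded, so it meets the connected exterior of a large
disc; hence there is only one. -/
theorem isPreconnected_compl_of_retract (hΓ : IsCompact Γ) (hr : Continuous r)
    (hrΓ : ∀ w ∈ Γ, r w = w) (hr' : ∀ w, r w ∈ Γ) : IsPreconnected Γᶜ := by
  obtain ⟨R, hR⟩ := hΓ.isBounded.exists_norm_le
  have hE : {w : ℂ | |R| < ‖w‖} ⊆ Γᶜ := fun w hw hwΓ =>
    absurd ((hR w hwΓ).trans (le_abs_self R)) (not_le.2 hw)
  have hw₀ : ((|R| + 1 : ℝ) : ℂ) ∈ {w : ℂ | |R| < ‖w‖} := by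
    have h0 : 0 < |R| + 1 := by positivity
    simp only [mem_ofPred_eq, Complex.norm_real, Real.norm_eq_abs]
    rw [abs_of_pos h0]
    linarith
  have key : Γᶜ = connectedComponentIn Γᶜ ((|R| + 1 : ℝ) : ℂ) := by
    refine Subset.antisymm (fun z hz => ?_) (connectedComponentIn_subset _ _)
    obtain ⟨w, hw, hwR⟩ := not_bounded_connectedComponentIn hΓ.isClosed hr hrΓ hr' hz |R|
    have h1 : w ∈ connectedComponentIn Γᶜ ((|R| + 1 : ℝ) : ℂ) :=
      (isPreconnected_exterior R).subset_connectedComponentIn hw₀ hE hwR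
    rw [connectedComponentIn_eq h1, ← connectedComponentIn_eq hw]
    exact mem_connectedComponentIn hz
  rw [key]
  exact isPreconnected_connectedComponentIn

end Retract

/-! ### Uniqueness of normal forms -/

section Uniqueness

theorem continuous_cauchyKernel {X : Type*} [TopologicalSpace X] {γ : X → ℂ} (hγ : Continuous γ)
    {z : ℂ} (hz : z ∉ range γ) (k : ℕ) : Continuous fun t => 1 / (γ t - z) ^ k :=
  continuous_const.div ((hγ.sub continuous_const).pow _) fun t =>
    pow_ne_zero _ (sub_ne_zero.2 fun h => hz ⟨t, h⟩)

theorem exists_compl_range_gt {X : Type*} [TopologicalSpace X] [CompactSpace X] {γ : X → ℂ}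
    (hγ : Continuous γ) : ∃ T : ℝ, ∀ x : ℝ, T < x → (x : ℂ) ∉ range γ := by
  obtain ⟨T, hT⟩ := (isCompact_range hγ).isBounded.exists_norm_le
  refine ⟨T, fun x hx h => ?_⟩
  have h1 := hT _ h
  rw [Complex.norm_real, Real.norm_eq_abs] at h1
  linarith [le_abs_self x]

variable {X : Type*} [MeasurableSpace X] {γ : X → ℂ} {ν : Measure X} {h : X → ℂ}

/-- The Cauchy-type integral `∫ h dν / (γ - z) ^ k`. -/
def cauchyInt (γ : X → ℂ) (ν : Measure X) (h : X → ℂ) (k : ℕ) (z : ℂ) : ℂ :=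
  ∫ t, 1 / (γ t - z) ^ k * h t ∂ν

theorem norm_cauchyInt_le {T : ℝ} (hT : ∀ t, ‖γ t‖ ≤ T) (hh : Integrable h ν) {z : ℂ}
    (hz : 2 * T ≤ ‖z‖) (hz0 : 0 < ‖z‖) (k : ℕ) :
    ‖cauchyInt γ ν h k z‖ ≤ (2 / ‖z‖) ^ k * ∫ t, ‖h t‖ ∂ν := by
  rw [cauchyInt, ← integral_const_mul]
  refine norm_integral_le_of_norm_le (hh.norm.const_mul _) (Eventually.of_forall fun t => ?_)
  rw [norm_mul, norm_div, norm_one, norm_pow, ← one_div_pow]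
  have h1 : ‖z‖ / 2 ≤ ‖γ t - z‖ := by
    have := norm_sub_norm_le z (γ t)
    rw [norm_sub_rev]
    linarith [hT t]
  have h2 : 1 / ‖γ t - z‖ ≤ 2 / ‖z‖ := by
    rw [show 2 / ‖z‖ = 1 / (‖z‖ / 2) by field_simp]
    gcongr
  gcongr

variable [TopologicalSpace X] [CompactSpace X]

theorem tendsto_pow_mul_cauchyInt (hγ : Continuous γ) (hh : Integrable h ν) (p : ℂ) (k : ℕ) :
    Tendsto (fun x : ℝ => (p - x) ^ k * cauchyInt γ ν h (k + 1) x) atTop (𝓝 0) := by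
  obtain ⟨T, hT⟩ := (isCompact_range hγ).isBounded.exists_norm_le
  have hlim : Tendsto (fun x : ℝ => 2 ^ k * 2 ^ (k + 1) * (∫ t, ‖h t‖ ∂ν) * x⁻¹) atTop (𝓝 0) := by
    simpa using tendsto_inv_atTop_zero.const_mul (2 ^ k * 2 ^ (k + 1) * (∫ t, ‖h t‖ ∂ν))
  refine squeeze_zero_norm' ?_ hlim
  filter_upwards [eventually_gt_atTop 0, eventually_ge_atTop (2 * T), eventually_ge_atTop ‖p‖]
    with x hx hxT hxp
  have hxn : ‖(x : ℂ)‖ = x := by rw [Complex.norm_real, Real.norm_eq_abs, abs_of_pos hx]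
  have h1 := norm_cauchyInt_le (fun t => hT _ (mem_range_self t)) hh (z := (x : ℂ))
    (by rwa [hxn]) (by rwa [hxn]) (k + 1)
  rw [hxn] at h1
  have h2 : ‖p - x‖ ≤ 2 * x := (norm_sub_le _ _).trans (by rw [hxn]; linarith)
  rw [norm_mul, norm_pow]
  have hI : 0 ≤ ∫ t, ‖h t‖ ∂ν := integral_nonneg fun t => norm_nonneg _
  calc ‖p - x‖ ^ k * ‖cauchyInt γ ν h (k + 1) x‖
      ≤ (2 * x) ^ k * ((2 / x) ^ (k + 1) * ∫ t, ‖h t‖ ∂ν) := by gcongr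
    _ = _ := by
      rw [div_pow, mul_pow]
      field_simp
      ring

variable [BorelSpace X]

theorem integrable_cauchyKernel (hγ : Continuous γ) (hh : Integrable h ν) {z : ℂ}
    (hz : z ∉ range γ) (k : ℕ) : Integrable (fun t => 1 / (γ t - z) ^ k * h t) ν := by
  obtain ⟨C, hC⟩ := (isCompact_range (continuous_cauchyKernel hγ hz k)).isBounded.exists_norm_le
  exact hh.bdd_mul (continuous_cauchyKernel hγ hz k).measurable.aestronglyMeasurable
    (Eventually.of_forall fun t => hC _ (mem_range_self t))

theorem hasDerivAt_cauchyInt (hγ : Continuous γ) (hh : Integrable h ν) {z : ℂ}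
    (hz : z ∉ range γ) (k : ℕ) :
    HasDerivAt (cauchyInt γ ν h k) (k * cauchyInt γ ν h (k + 1) z) z := by
  rcases isEmpty_or_nonempty X with hX | hX
  · have : cauchyInt γ ν h k = fun _ => 0 := by
      funext z; rw [cauchyInt, integral_of_isEmpty]
    rw [this, cauchyInt, integral_of_isEmpty, mul_zero]
    exact hasDerivAt_const z 0
  have hcl : IsClosed (range γ) := (isCompact_range hγ).isClosed
  set δ := Metric.infDist z (range γ) with hδ
  have hδ0 : 0 < δ := (hcl.notMem_iff_infDist_pos (range_nonempty γ)).1 hz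
  have hfar : ∀ x ∈ Metric.ball z (δ / 2), ∀ t, δ / 2 ≤ ‖γ t - x‖ := by
    intro x hx t
    have h1 : δ ≤ dist z (γ t) := Metric.infDist_le_dist_of_mem (mem_range_self t)
    have h2 := dist_triangle z x (γ t)
    rw [Metric.mem_ball, dist_comm] at hx
    rw [← dist_eq_norm, dist_comm]
    linarith
  have hnotin : ∀ x ∈ Metric.ball z (δ / 2), x ∉ range γ := by
    rintro x hx ⟨t, rfl⟩
    have := hfar _ hx t
    rw [sub_self, norm_zero] at this
    linarith
  have key := hasDerivAt_integral_of_dominated_loc_of_deriv_le (μ := ν)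
    (F := fun x t => 1 / (γ t - x) ^ k * h t)
    (F' := fun x t => k * (1 / (γ t - x) ^ (k + 1) * h t)) (x₀ := z)
    (s := Metric.ball z (δ / 2)) (bound := fun t => k * (1 / (δ / 2) ^ (k + 1)) * ‖h t‖)
    (Metric.ball_mem_nhds z (half_pos hδ0)) ?_ (integrable_cauchyKernel hγ hh hz k) ?_ ?_
    (hh.norm.const_mul _) ?_
  · have h2 := key.2
    rw [integral_const_mul] at h2
    exact h2
  · filter_upwards [Metric.ball_mem_nhds z (half_pos hδ0)] with x hx
    exact (integrable_cauchyKernel hγ hh (hnotin x hx) k).aestronglyMeasurable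
  · exact ((integrable_cauchyKernel hγ hh hz (k + 1)).const_mul _).aestronglyMeasurable
  · refine Eventually.of_forall fun t x hx => ?_
    rw [norm_mul, norm_mul, norm_div, norm_one, norm_pow, Complex.norm_natCast, ← mul_assoc]
    have := hfar x hx t
    gcongr
  · refine Eventually.of_forall fun t x hx => ?_
    have hne : γ t - x ≠ 0 := sub_ne_zero.2 fun e => hnotin x hx ⟨t, e⟩
    have h1 : HasDerivAt (fun x => γ t - x) (-1) x := by
      simpa using (hasDerivAt_id x).const_sub (γ t)
    have h2 := ((h1.pow k).inv (pow_ne_zero _ hne)).mul_const (h t)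
    simp only [one_div]
    convert! h2 using 1
    rcases k with _ | k
    · simp
    · simp only [Pi.pow_apply, Nat.add_sub_cancel]
      field_simp
      ring

/-- The derivative of the integral of order `k + 1` is `k + 1` times that of order `k + 2`. It is
therefore constant on the connected complement, and its limit at infinity is zero. -/
theorem cauchyInt_eq_zero_of_succ (hγ : Continuous γ) (hh : Integrable h ν)
    (hconn : IsPreconnected (range γ)ᶜ) {k : ℕ}
    (h0 : ∀ z ∉ range γ, cauchyInt γ ν h (k + 2) z = 0) :
    ∀ z ∉ range γ, cauchyInt γ ν h (k + 1) z = 0 := by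
  intro z hz
  have hd : ∀ x ∈ (range γ)ᶜ, HasDerivAt (cauchyInt γ ν h (k + 1)) 0 x := fun x hx => by
    have := hasDerivAt_cauchyInt hγ hh hx (k + 1)
    rwa [h0 x hx, mul_zero] at this
  obtain ⟨T, hT⟩ := exists_compl_range_gt hγ
  have hlim : Tendsto (fun x : ℝ => cauchyInt γ ν h (k + 1) x) atTop (𝓝 0) := by
    obtain ⟨T', hT'⟩ := (isCompact_range hγ).isBounded.exists_norm_le
    have hl : Tendsto (fun x : ℝ => (2 / x) ^ (k + 1) * ∫ t, ‖h t‖ ∂ν) atTop (𝓝 0) := by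
      have h1 : Tendsto (fun x : ℝ => 2 / x) atTop (𝓝 0) := tendsto_const_nhds.div_atTop tendsto_id
      simpa using (h1.pow (k + 1)).mul_const (∫ t, ‖h t‖ ∂ν)
    refine squeeze_zero_norm' ?_ hl
    filter_upwards [eventually_gt_atTop 0, eventually_ge_atTop (2 * T')] with x hx hxT
    have hxn : ‖(x : ℂ)‖ = x := by rw [Complex.norm_real, Real.norm_eq_abs, abs_of_pos hx]
    have h1 := norm_cauchyInt_le (fun t => hT' _ (mem_range_self t)) hh (z := (x : ℂ))
      (by rwa [hxn]) (by rwa [hxn]) (k + 1)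
    rwa [hxn] at h1
  refine tendsto_nhds_unique (tendsto_const_nhds.congr' ?_) hlim
  filter_upwards [eventually_gt_atTop T] with x hx
  exact (isCompact_range hγ).isClosed.isOpen_compl.is_const_of_deriv_eq_zero hconn
    (fun x hx => (hd x hx).differentiableAt.differentiableWithinAt)
    (fun x hx => (hd x hx).deriv) hz (hT x hx)

theorem cauchyInt_one_eq_zero (hγ : Continuous γ) (hh : Integrable h ν)
    (hconn : IsPreconnected (range γ)ᶜ) (k : ℕ)
    (h0 : ∀ z ∉ range γ, cauchyInt γ ν h (k + 1) z = 0) :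
    ∀ z ∉ range γ, cauchyInt γ ν h 1 z = 0 := by
  induction k with
  | zero => exact h0
  | succ k ih => exact ih (cauchyInt_eq_zero_of_succ hγ hh hconn h0)

/-- Write `F (γ t)` by Cauchy–Pompeiu as an area integral of `∂̄F` and exchange the integrals: the
inner one becomes the Cauchy transform, which is zero for almost every `w` because `Γ` is null. -/
theorem integral_comp_mul_eq_zero [IsFiniteMeasure ν] (hγ : Continuous γ) (hh : Integrable h ν)
    (hnull : volume (range γ) = 0) (h0 : ∀ z ∉ range γ, cauchyInt γ ν h 1 z = 0) {F : ℂ → ℂ}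
    (hF : ContDiff ℝ 1 F) (hc : HasCompactSupport F) : ∫ t, F (γ t) * h t ∂ν = 0 := by
  have hlip : ∀ x, LipAt F x := fun x => LipAt.of_contDiffAt hF.contDiffAt
  obtain ⟨K, hK⟩ := exists_lipschitzWith_of_lipAt hlip hc
  have hpi : (-Real.pi : ℂ) ≠ 0 := by
    rw [neg_ne_zero]; exact_mod_cast Real.pi_ne_zero
  have hbound : ∀ p w, ‖dbar F w * (w - p)⁻¹‖ ≤ kernelBound K (tsupport F) p w := fun p w =>
    norm_mul_le_kernelBound (norm_dbar_le hK w) (norm_inv _).le dbar_eq_zero_of_notMem_tsupport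
  have hmeas : ∀ p, AEStronglyMeasurable (fun w => dbar F w * (w - p)⁻¹) := fun p =>
    ((measurable_dbar F).mul (by fun_prop)).aestronglyMeasurable
  have hint : ∀ p, Integrable (fun w => dbar F w * (w - p)⁻¹) := fun p =>
    (integrable_kernelBound K hc.isCompact p).mono' (hmeas p)
      (Eventually.of_forall fun w => hbound p w)
  set C : ℝ := K * (∫ w, diskKernel w) + ∫ w, (tsupport F).indicator (fun _ : ℂ => (K : ℝ)) w with hC
  have hnorm : ∀ p, ∫ w, ‖dbar F w * (w - p)⁻¹‖ ≤ C := fun p => by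
    rw [hC, ← integral_kernelBound K hc.isCompact p]
    exact integral_mono (hint p).norm (integrable_kernelBound K hc.isCompact p) fun w => hbound p w
  have hjoint : Integrable (Function.uncurry fun t w => dbar F w * (w - γ t)⁻¹ * h t)
      (ν.prod volume) := by
    have hm : AEStronglyMeasurable (Function.uncurry fun t w => dbar F w * (w - γ t)⁻¹ * h t)
        (ν.prod volume) := by
      have h1 : Measurable fun q : X × ℂ => dbar F q.2 * (q.2 - γ q.1)⁻¹ := by
        have := hγ.measurable
        have := measurable_dbar F
        fun_prop
      exact h1.aestronglyMeasurable.mul hh.aestronglyMeasurable.comp_fst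
    rw [integrable_prod_iff hm]
    refine ⟨Eventually.of_forall fun t => (hint (γ t)).mul_const (h t), ?_⟩
    refine (hh.norm.const_mul C).mono' hm.norm.integral_prod_right' (Eventually.of_forall fun t => ?_)
    rw [Real.norm_eq_abs, abs_of_nonneg (integral_nonneg fun w => norm_nonneg _)]
    simp only [Function.uncurry, norm_mul (dbar F _ * _), integral_mul_const]
    gcongr
    exact hnorm _
  apply mul_left_cancel₀ hpi
  rw [mul_zero, ← integral_const_mul]
  have e1 : ∀ t, -Real.pi * (F (γ t) * h t) = ∫ w, dbar F w * (w - γ t)⁻¹ * h t := fun t => by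
    rw [integral_mul_const, integral_dbar_div hlip hc]
    ring
  simp only [e1]
  rw [integral_integral_swap hjoint]
  refine integral_eq_zero_of_ae ?_
  filter_upwards [measure_eq_zero_iff_ae_notMem.1 hnull] with w hw
  have e2 : ∀ t, dbar F w * (w - γ t)⁻¹ * h t = -dbar F w * (1 / (γ t - w) ^ 1 * h t) := fun t => by
    rw [pow_one, one_div, ← neg_sub (γ t) w, inv_neg]
    ring
  simp only [e2]
  rw [integral_const_mul]
  have := h0 w hw
  rw [cauchyInt] at this
  rw [this, mul_zero]
  rfl

/-- Pushed forward along the closed embedding `γ`, the density becomes `h ∘ τ` on the plane, where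
smooth test functions detect it. -/
theorem ae_eq_zero_of_cauchyInt_one [IsFiniteMeasure ν] (hγ : Continuous γ)
    (hh : Integrable h ν) (hnull : volume (range γ) = 0) {τ : ℂ → X} (hτ : ∀ t, τ (γ t) = t)
    (h0 : ∀ z ∉ range γ, cauchyInt γ ν h 1 z = 0) : h =ᵐ[ν] 0 := by
  have hemb : MeasurableEmbedding γ :=
    (hγ.isClosedEmbedding (Function.LeftInverse.injective hτ)).measurableEmbedding
  have hcomp : (h ∘ τ) ∘ γ = h := by
    funext t; simp [hτ]
  have hint : Integrable (h ∘ τ) (ν.map γ) := by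
    rw [hemb.integrable_map_iff, hcomp]
    exact hh
  have h1 := ae_eq_zero_of_integral_contDiff_smul_eq_zero hint.locallyIntegrable
    (fun g hg hgc => by
      rw [hemb.integral_map]
      have hF : ContDiff ℝ 1 fun w => (g w : ℂ) :=
        Complex.ofRealCLM.contDiff.comp (hg.of_le (by exact_mod_cast le_top))
      have hFc : HasCompactSupport fun w => (g w : ℂ) :=
        hgc.comp_left (g := fun t : ℝ => (t : ℂ)) Complex.ofReal_zero
      have := integral_comp_mul_eq_zero hγ hh hnull h0 hF hFc
      simpa [hτ] using this)
  rw [hemb.ae_map_iff] at h1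
  filter_upwards [h1] with t ht
  simpa [hτ] using ht

end Uniqueness

/-- Multiplied by `(p - x) ^ m` the sum becomes a polynomial in `p - x` tending to zero. A
polynomial of positive degree would be unbounded, so it is constant, and the constant is zero. -/
theorem eq_zero_of_sum_div_pow {m : ℕ} {c : Fin (m + 1) → ℂ} {p : ℂ} {I : ℝ → ℂ}
    (hI : Tendsto (fun x : ℝ => (p - x) ^ m * I x) atTop (𝓝 0))
    (h : ∀ᶠ x : ℝ in atTop, ∑ j : Fin (m + 1), c j / (p - x) ^ (j : ℕ) + I x = 0) : c = 0 := by
  let Q : Polynomial ℂ := ∑ j : Fin (m + 1), Polynomial.C (c j) * Polynomial.X ^ (m - (j : ℕ))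
  have hnorm : Tendsto (fun x : ℝ => ‖p - x‖) atTop atTop := by
    refine tendsto_atTop_mono (f := fun x : ℝ => x - ‖p‖) (fun x => ?_)
      (tendsto_atTop_add_const_right _ _ tendsto_id)
    have := norm_sub_norm_le (x : ℂ) p
    rw [Complex.norm_real, Real.norm_eq_abs, norm_sub_rev] at this
    linarith [le_abs_self x]
  have hQ : Tendsto (fun x : ℝ => Q.eval (p - x)) atTop (𝓝 0) := by
    have := hI.neg
    rw [neg_zero] at this
    refine this.congr' ?_
    filter_upwards [h, hnorm.eventually_gt_atTop 0] with x hx hpx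
    have hp0 : p - x ≠ 0 := norm_pos_iff.1 hpx
    have e : Q.eval (p - x) = (p - x) ^ m * ∑ j : Fin (m + 1), c j / (p - x) ^ (j : ℕ) := by
      simp only [Q, Polynomial.eval_finsetSum, Polynomial.eval_mul, Polynomial.eval_C,
        Polynomial.eval_pow, Polynomial.eval_X]
      rw [Finset.mul_sum]
      refine Finset.sum_congr rfl fun j _ => ?_
      rw [pow_sub₀ _ hp0 (Nat.lt_succ_iff.1 j.2)]
      ring
    rw [e, eq_neg_of_add_eq_zero_left hx]
    ring
  have hQ0 : Q = 0 := by
    have hdeg : Q.degree ≤ 0 := by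
      by_contra hd
      have h1 := Q.tendsto_norm_atTop (not_le.1 hd) hnorm
      exact not_tendsto_nhds_of_tendsto_atTop h1 _ hQ.norm
    rw [Polynomial.eq_C_of_degree_le_zero hdeg] at hQ ⊢
    simp only [Polynomial.eval_C] at hQ
    rw [tendsto_nhds_unique tendsto_const_nhds hQ, Polynomial.C_0]
  funext j
  have h1 : Q.coeff (m - (j : ℕ)) = c j := by
    simp only [Q, Polynomial.finsetSum_coeff, Polynomial.coeff_C_mul_X_pow]
    rw [Finset.sum_eq_single j]
    · simp
    · intro i _ hij
      refine if_neg fun e => hij (Fin.ext ?_)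
      have := i.2
      have := j.2
      omega
    · simp
  rw [← h1, hQ0, Polynomial.coeff_zero, Pi.zero_apply]

theorem normalForm_unique {a b : ℝ} (hab : a ≤ b) {γ : Icc a b → ℂ} (hγ : IsLipschitzCurve γ)
    {f : OnePoint ℂ → ℂ} (n : ℕ) (t₀ : Icc a b) (d d' : NormalFormData a b n)
    (hd : IsSimpleNormalForm γ f n t₀ d) (hd' : IsSimpleNormalForm γ f n t₀ d') : d = d' := by
  obtain ⟨K, hK⟩ := hγ.lipschitz
  obtain ⟨L, hL⟩ := hγ.antilipschitz
  have hc := hK.continuous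
  obtain ⟨T, hT⟩ := exists_compl_range_gt hc
  match n, d, d' with
  | 0, d, d' =>
    have hz := hT (T + 1) (by linarith)
    exact (hd _ hz).symm.trans (hd' _ hz)
  | m + 1, (c, μ), (c', μ') =>
    obtain ⟨R, -, -, hret⟩ := exists_lipschitz_retraction hK hL
    obtain ⟨τ, M, hτ, hτγ, -⟩ := hret t₀
    have hconn : IsPreconnected (range γ)ᶜ :=
      isPreconnected_compl_of_retract (r := fun w => γ (τ w)) (isCompact_range hc)
        (hc.comp hτ.continuous) (by rintro _ ⟨t, rfl⟩; rw [hτγ]) fun w => mem_range_self _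
    -- A single density for the difference of the two measures turns the claim into the vanishing of
    -- a Cauchy-type integral.
    obtain ⟨ν, h, hν, hh, hμ⟩ := exists_eq_withDensityᵥ (μ - μ')
    have hvar : ∀ μ : ComplexMeasure (Icc a b), IsFiniteMeasure μ.variation := fun μ => by
      obtain ⟨ν, h, hν, hh, rfl⟩ := exists_eq_withDensityᵥ μ
      exact isFiniteMeasure_variation_withDensityᵥ hh
    have hsub : ∀ z ∉ range γ, ∑ j : Fin (m + 1), (c j - c' j) / (γ t₀ - z) ^ (j : ℕ) +
        cauchyInt γ ν h (m + 1) z = 0 := by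
      intro z hz
      have hk := continuous_cauchyKernel hc hz (m + 1)
      obtain ⟨C, hC⟩ := (isCompact_range hk).isBounded.exists_norm_le
      have hC' : ∀ t, ‖1 / (γ t - z) ^ (m + 1)‖ ≤ C := fun t => hC _ (mem_range_self t)
      have hi : ∀ μ : ComplexMeasure (Icc a b),
          Integrable (fun t => 1 / (γ t - z) ^ (m + 1)) μ.variation := fun μ => by
        have := hvar μ
        exact Integrable.of_bound hk.measurable.aestronglyMeasurable C (Eventually.of_forall hC')
      have e1 : cintegral (μ - μ') (fun t => 1 / (γ t - z) ^ (m + 1)) =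
          cintegral μ (fun t => 1 / (γ t - z) ^ (m + 1)) -
            cintegral μ' (fun t => 1 / (γ t - z) ^ (m + 1)) :=
        VectorMeasure.integral_sub_vectorMeasure (hi μ) (hi μ')
      rw [hμ, cintegral_withDensityᵥ hh hk.stronglyMeasurable hC'] at e1
      have e2 := (hd z hz).symm.trans (hd' z hz)
      simp only [normalFormFun] at e2
      simp only [sub_div, Finset.sum_sub_distrib]
      rw [cauchyInt, e1]
      linear_combination e2
    have hcoef : (fun j => c j - c' j) = 0 :=
      eq_zero_of_sum_div_pow (tendsto_pow_mul_cauchyInt hc hh (γ t₀) m) (by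
        filter_upwards [eventually_gt_atTop T] with x hx
        exact hsub x (hT x hx))
    have hcauchy : ∀ z ∉ range γ, cauchyInt γ ν h (m + 1) z = 0 := fun z hz => by
      have := hsub z hz
      simp only [fun j => congrFun hcoef j, Pi.zero_apply, zero_div, Finset.sum_const_zero,
        zero_add] at this
      exact this
    have hzero := ae_eq_zero_of_cauchyInt_one hc hh (volume_range_eq_zero hab hK) hτγ
      (cauchyInt_one_eq_zero hc hh hconn m hcauchy)
    have hμ0 : μ - μ' = 0 := by
      rw [hμ, WithDensityᵥEq.congr_ae hzero, withDensityᵥ_zero]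
    have h1 : c = c' := funext fun j => sub_eq_zero.1 (congrFun hcoef j)
    rw [h1, sub_eq_zero.1 hμ0]

end LipCurve

end

theorem mainTheorem4 {a b : ℝ} (hab : a < b) (γ : Set.Icc a b → ℂ)
    (hγ : LipCurve.IsLipschitzCurve γ) :
    (∀ f ∈ LipCurve.slowlyGrowing (LipCurve.sphereTrace γ),
      ∃ n : ℕ, ∀ t₀ : Set.Icc a b, ∃ d : LipCurve.NormalFormData a b n,
        LipCurve.IsSimpleNormalForm γ f n t₀ d) ∧
    (∀ f ∈ LipCurve.slowlyGrowing (LipCurve.sphereTrace γ),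
      ∀ (n : ℕ) (t₀ : Set.Icc a b) (d d' : LipCurve.NormalFormData a b n),
        LipCurve.IsSimpleNormalForm γ f n t₀ d → LipCurve.IsSimpleNormalForm γ f n t₀ d' →
          d = d') :=
  ⟨fun _ hf => LipCurve.exists_normalForm hab.le hγ hf,
    fun _ _ n t₀ d d' hd hd' => LipCurve.normalForm_unique hab.le hγ n t₀ d d' hd hd'⟩
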